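/- Conventions. Let $f\colon X\to X$ be a continuous self-map of a compact metric space $(X,d)$. *Shadowing.* A sequence $(x_i)_{i\ge0}$ is a $\delta$-pseudo orbit if $d(f(x_i),x_{i+1})\le\delta$ for all $i\ge 0$; it is $\epsilon$-shadowed by $y$ if $d(f^i(y),x_i)\le\epsilon$ for all $i\ge0$. $f$ has the shadowing property if for every $\epsilon>0$ there is $\delta>0$ such that every $\delta$-pseudo orbit is $\epsilon$-shadowed by some point of $X$; $Sh(f)$ is the set of $x\in X$ such that for every $\epsilon>0$ there is $\delta>0$ such that every $\delta$-pseudo orbit with $x_0=x$ is $\epsilon$-shadowed by some point of $X$. *Chain components.* A $\delta$-chain is a finite sequence $(x_i)_{i=0}^k$, $k>0$, with $d(f(x_i),x_{i+1})\le\delta$ for $0\le i\le k-1$. Write $x\to y$ if for every $\delta>0$ there is a $\delta$-chain from $x$ to $y$. Let $CR(f)=\{x: x\to x\}$; the set $\mathcal C(f)$ of chain components consists of the equivalence classes in $CR(f)$ of the relation "$x\to y$ and $y\to x$". A chain component $C$ is terminal if for every $\epsilon>0$ there is $\delta>0$ such that every $\delta$-chain with $x_0\in C$ satisfies $d(x_k,C)\le\epsilon$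 (and $C$ is closed with $f(C)\subset C$); $\mathcal C_{\rm ter}(f)$ is the set of terminal chain components. *Entropy points.* For $K\subset X$ and $r>0$ let $s_n(f,K,r)$ be the largest cardinality of a set $E\subset K$ such that $\max_{0\le i\le n-1}d(f^i(x),f^i(y))>r$ for all distinct $x,y\in E$, and let $h(f,K,r)=\limsup_{n\to\infty}\frac1n\log s_n(f,K,r)$. $Ent_{up}(f)$ is the set of $x\in X$ for which there are $r,b>0$ such that $h(f,K,r)\ge b$ for all closed neighborhoods $K$ of $x$. $E_1(f)$ is the set of $x\in X$ for which there is $y\ne x$ such that, for all disjoint closed neighborhoods $A$ of $x$ and $B$ of $y$, the open cover $\{X\setminus A,X\setminus B\}$ has positive topological entropy with respect to $f$. The example. Equip $[-1,1]^{\mathbb Z}$ with $d(x,y)=\sup_{n\in\mathbb Z}2^{-|n|}|x_n-y_n|$ and let $\sigma(x)_n=x_{n+1}$. Let $s=(s_k)_{k\ge1}$ satisfy $0<s_1<s_2<\cdots$ and $\lim_k s_k=1$, and put $S=\{-1,1\}\cup\{\pm s_k:k\ge1\}$. Let $X$ be the set of $x\in S^{\mathbb Z}$ such that, for all $n\in\mathbb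 Z$: $|x_n|\le|x_{n+1}|$; if $x_n=s_k$ with $k\ge1$, then $x_{n+j}=-s_k$ for $1\le j\le k$; if $x_n=1$, then $x_{n+j}=-1$ for all $j\ge1$. Let $f=\sigma|_X$, $X_k=X\cap\{-s_k,s_k\}^{\mathbb Z}$ for $k\ge 1$, and $X_\infty=X\cap\{-1,1\}^{\mathbb Z}$. Let $z$ be the point of $[-1,1]^{\mathbb Z}$ with all coordinates $-1$, and $z^{(m)}$, $m\in\mathbb Z$, the point with $m$-th coordinate $1$ and all other coordinates $-1$. **Statement.** (i) For every such $s$: $X$ is a closed, compact, $\sigma$-invariant subset of $[-1,1]^{\mathbb Z}$, and $f\colon X\to X$ is a homeomorphism; $X_\infty=\{z\}\cup\{z^{(m)}:m\in\mathbb Z\}$; $CR(f)=\{x\in X:|x_n|=|x_{n+1}|\text{ for all }n\in\mathbb Z\}=X_\infty\cup\bigcup_{k\ge1}X_k$; $\mathcal C(f)=\{X_\infty\}\cup\{X_k:k\ge1\}$; $\mathcal C_{\rm ter}(f)=\{X_\infty\}$; $X_\infty$ is infinite, and $X_\infty\subset E_1(f)\setminus Ent_{up}(f)$. (ii) The sequence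 $s$ can be chosen so that, in addition, $f$ has the shadowing property, and $X=Sh(f)$. (iii) Consequently, the question of Ye and Zhang whether $E_1(g)\subset Ent_{up}(g)$ for every homeomorphism $g$ of a compact metric space has a negative answer. -/

import Mathlib

open Set Filter Topology

namespace TopDyn

/-! ### Shadowing, chains, entropy points for a self-map of a metric space -/

section General

variable {X : Type*} [MetricSpace X]

/-- `x` is a `δ`-pseudo orbit of `f`. -/
def IsPseudoOrbit (f : X → X) (δ : ℝ) (x : ℕ → X) : Prop :=
  ∀ i : ℕ, dist (f (x i)) (x (i + 1)) ≤ δ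

/-- The sequence `x` is `ε`-shadowed by the point `y`. -/
def IsShadowedBy (f : X → X) (ε : ℝ) (x : ℕ → X) (y : X) : Prop :=
  ∀ i : ℕ, dist (f^[i] y) (x i) ≤ ε

/-- The set `Sh(f)` of shadowable points. -/
def shadowablePoints (f : X → X) : Set X :=
  {p | ∀ ε : ℝ, 0 < ε → ∃ δ : ℝ, 0 < δ ∧
    ∀ x : ℕ → X, IsPseudoOrbit f δ x → x 0 = p → ∃ y, IsShadowedBy f ε x y}

/-- The shadowing property. -/
def HasShadowing (f : X → X) : Prop :=
  ∀ ε : ℝ, 0 < ε → ∃ δ : ℝ, 0 < δ ∧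
    ∀ x : ℕ → X, IsPseudoOrbit f δ x → ∃ y, IsShadowedBy f ε x y

/-- `x 0, …, x k` is a `δ`-chain of `f` (with `k > 0`); later values of `x` are irrelevant. -/
def IsDeltaChain (f : X → X) (δ : ℝ) (k : ℕ) (x : ℕ → X) : Prop :=
  0 < k ∧ ∀ i : ℕ, i < k → dist (f (x i)) (x (i + 1)) ≤ δ

/-- The relation `x → y`. -/
def ChainsTo (f : X → X) (x y : X) : Prop :=
  ∀ δ : ℝ, 0 < δ → ∃ (k : ℕ) (c : ℕ → X), IsDeltaChain f δ k c ∧ c 0 = x ∧ c k = y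

/-- The chain recurrent set `CR(f)`. -/
def chainRecurrentSet (f : X → X) : Set X :=
  {x | ChainsTo f x x}

/-- The set of chain components: the equivalence classes in `CR(f)` of the relation
"`x → y` and `y → x`". -/
def chainComponents (f : X → X) : Set (Set X) :=
  {C | ∃ x ∈ chainRecurrentSet f,
    C = {y | y ∈ chainRecurrentSet f ∧ ChainsTo f x y ∧ ChainsTo f y x}}

/-- Chain stable sets (closed and invariant sets that `δ`-chains cannot leave by far). -/
def IsChainStable (f : X → X) (S : Set X) : Prop :=
  IsClosed S ∧ MapsTo f S S ∧
    ∀ ε : ℝ, 0 < ε → ∃ δ : ℝ, 0 < δ ∧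
      ∀ (k : ℕ) (c : ℕ → X), IsDeltaChain f δ k c → c 0 ∈ S → Metric.infDist (c k) S ≤ ε

/-- The set of terminal chain components. -/
def terminalChainComponents (f : X → X) : Set (Set X) :=
  {C | C ∈ chainComponents f ∧ IsChainStable f C}

/-- `E` is `(n, r)`-separated: distinct points of `E` are more than `r` apart at some time
`i ≤ n - 1`. -/
def IsSeparatedSet (f : X → X) (n : ℕ) (r : ℝ) (E : Set X) : Prop :=
  ∀ x ∈ E, ∀ y ∈ E, x ≠ y → ∃ i : ℕ, i < n ∧ r < dist (f^[i] x) (f^[i] y)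

/-- `s_n(f, K, r)`: the largest cardinality of an `(n, r)`-separated subset of `K`. -/
noncomputable def sepCard (f : X → X) (K : Set X) (r : ℝ) (n : ℕ) : ℕ∞ :=
  ⨆ (E : Finset X) (_ : (E : Set X) ⊆ K ∧ IsSeparatedSet f n r (E : Set X)), (E.card : ℕ∞)

/-- `h(f, K, r) = limsup (1/n) log s_n(f, K, r)`. -/
noncomputable def sepEntropy (f : X → X) (K : Set X) (r : ℝ) : EReal :=
  limsup (fun n : ℕ => ENNReal.log ((sepCard f K r n : ℕ∞) : ENNReal) / (n : EReal)) atTop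

/-- `Ent_{r,b}(f)`. -/
def entRB (f : X → X) (r b : ℝ) : Set X :=
  {x | ∀ K : Set X, IsClosed K → K ∈ 𝓝 x → (b : EReal) ≤ sepEntropy f K r}

/-- The set `Ent_up(f)` of uniform entropy points. -/
def uniformEntropyPoints (f : X → X) : Set X :=
  {x | ∃ r b : ℝ, 0 < r ∧ 0 < b ∧ x ∈ entRB f r b}

/-- The common refinement of `𝒰, f⁻¹𝒰, …, f^{-(n-1)}𝒰`. -/
def iteratedCover (f : X → X) (𝒰 : Set (Set X)) (n : ℕ) : Set (Set X) :=
  {V | ∃ c : ℕ → Set X, (∀ i, i < n → c i ∈ 𝒰) ∧ V = {x | ∀ i, i < n → f^[i] x ∈ c i}}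

/-- The smallest cardinality of a finite subcover of `𝒱`. -/
noncomputable def minSubcoverCard (𝒱 : Set (Set X)) : ℕ∞ :=
  ⨅ (F : Finset (Set X)) (_ : (F : Set (Set X)) ⊆ 𝒱 ∧ ⋃₀ (F : Set (Set X)) = univ),
    (F.card : ℕ∞)

/-- The entropy `h(f, 𝒰)` of `f` relative to the open cover `𝒰`. For open covers of a compact
space the limit exists by subadditivity, so that it may be written as a `limsup`. -/
noncomputable def openCoverEntropy (f : X → X) (𝒰 : Set (Set X)) : EReal :=
  limsup (fun n : ℕ =>
    ENNReal.log ((minSubcoverCard (iteratedCover f 𝒰 n) : ℕ∞) : ENNReal) / (n : EReal)) atTop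

/-- `(x, y) ∈ E_2(f)`: entropy pairs. -/
def IsEntropyPair (f : X → X) (x y : X) : Prop :=
  x ≠ y ∧ ∀ A B : Set X, IsClosed A → A ∈ 𝓝 x → IsClosed B → B ∈ 𝓝 y → A ∩ B = ∅ →
    0 < openCoverEntropy f {Aᶜ, Bᶜ}

/-- The set `E_1(f)` of C-entropy points. -/
def cEntropyPoints (f : X → X) : Set X :=
  {x | ∃ y, IsEntropyPair f x y}

end General

/-! ### The sequence space `[-1,1]^ℤ` with its metric, and the shift -/

/-- The space `[-1,1]^ℤ`. -/
def SeqSpace : Type := ℤ → Set.Icc (-1 : ℝ) 1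

namespace SeqSpace

/-- The real number `x_n`. -/
def coord (x : SeqSpace) (n : ℤ) : ℝ := (x n : ℝ)

theorem ext_coord {x y : SeqSpace} (h : ∀ n, x.coord n = y.coord n) : x = y :=
  funext fun n => Subtype.ext (h n)

/-- The weighted distance in the coordinate `n`. -/
noncomputable def term (x y : SeqSpace) (n : ℤ) : ℝ :=
  (1 / 2 : ℝ) ^ n.natAbs * |x.coord n - y.coord n|

theorem term_nonneg (x y : SeqSpace) (n : ℤ) : 0 ≤ term x y n := by
  unfold term; positivity

theorem term_le_two (x y : SeqSpace) (n : ℤ) : term x y n ≤ 2 := by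
  have h1 : (1 / 2 : ℝ) ^ n.natAbs ≤ 1 := pow_le_one₀ (by norm_num) (by norm_num)
  have h2 : |x.coord n - y.coord n| ≤ 2 := by
    have hx := (x n).2
    have hy := (y n).2
    rw [abs_le]
    unfold coord
    constructor <;> linarith [hx.1, hx.2, hy.1, hy.2]
  calc term x y n ≤ 1 * 2 := mul_le_mul h1 h2 (abs_nonneg _) (by norm_num)
    _ = 2 := by norm_num

theorem bddAbove_term (x y : SeqSpace) : BddAbove (range (term x y)) :=
  ⟨2, by rintro _ ⟨n, rfl⟩; exact term_le_two x y n⟩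

/-- The metric `d(x, y) = sup_n 2^{-|n|} |x_n - y_n|`. -/
noncomputable instance : MetricSpace SeqSpace where
  dist x y := ⨆ n : ℤ, term x y n
  dist_self x := by simp [term]
  dist_comm x y := by simp [term, abs_sub_comm]
  dist_triangle x y z := by
    refine ciSup_le fun n => ?_
    have h1 : term x z n ≤ term x y n + term y z n := by
      unfold term
      rw [← mul_add]
      exact mul_le_mul_of_nonneg_left (abs_sub_le _ _ _) (by positivity)
    exact h1.trans (add_le_add (le_ciSup (bddAbove_term x y) n) (le_ciSup (bddAbove_term y z) n))
  eq_of_dist_eq_zero := by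
    intro x y h
    refine ext_coord fun n => ?_
    have h1 : term x y n ≤ 0 := (le_ciSup (bddAbove_term x y) n).trans_eq h
    have h2 : term x y n = 0 := le_antisymm h1 (term_nonneg x y n)
    unfold term at h2
    have h3 : (1 / 2 : ℝ) ^ n.natAbs ≠ 0 := by positivity
    exact sub_eq_zero.mp (abs_eq_zero.mp ((mul_eq_zero.mp h2).resolve_left h3))

theorem dist_def (x y : SeqSpace) :
    dist x y = ⨆ n : ℤ, (1 / 2 : ℝ) ^ n.natAbs * |x.coord n - y.coord n| := rfl

/-- The shift `σ(x)_n = x_{n+1}`. -/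
def shift (x : SeqSpace) : SeqSpace := fun n => x (n + 1)

/-- The point `z` all of whose coordinates are `-1`. -/
def zPoint : SeqSpace := fun _ => ⟨-1, by norm_num⟩

/-- The point `z^{(m)}` with coordinate `1` at `m` and `-1` elsewhere. -/
def zPointAt (m : ℤ) : SeqSpace :=
  fun n => if n = m then ⟨1, by norm_num⟩ else ⟨-1, by norm_num⟩

end SeqSpace

/-! ### The example; the sequence `s` is indexed by `k ≥ 1`, and `s 0` plays no role -/

/-- `0 < s_1 < s_2 < ⋯` and `s_k → 1`. -/
def IsAdmissible (s : ℕ → ℝ) : Prop :=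
  0 < s 1 ∧ (∀ k : ℕ, 1 ≤ k → s k < s (k + 1)) ∧ Tendsto s atTop (𝓝 1)

/-- `S = {-1, 1} ∪ {-s_k : k ≥ 1} ∪ {s_k : k ≥ 1}`. -/
def alphabet (s : ℕ → ℝ) : Set ℝ :=
  {-1, 1} ∪ {t | ∃ k : ℕ, 1 ≤ k ∧ t = -s k} ∪ {t | ∃ k : ℕ, 1 ≤ k ∧ t = s k}

/-- The subset `X` of `S^ℤ`. -/
def exampleSet (s : ℕ → ℝ) : Set SeqSpace :=
  {x | (∀ n : ℤ, x.coord n ∈ alphabet s) ∧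
    (∀ n : ℤ, |x.coord n| ≤ |x.coord (n + 1)|) ∧
    (∀ (n : ℤ) (k : ℕ), 1 ≤ k → x.coord n = s k →
      ∀ j : ℕ, 1 ≤ j → j ≤ k → x.coord (n + j) = -s k) ∧
    (∀ n : ℤ, x.coord n = 1 → ∀ j : ℕ, 1 ≤ j → x.coord (n + j) = -1)}

theorem shift_mapsTo (s : ℕ → ℝ) : MapsTo SeqSpace.shift (exampleSet s) (exampleSet s) := by
  rintro x ⟨h1, h2, h3, h4⟩
  have e : ∀ (n : ℤ) (j : ℕ), x.shift.coord (n + j) = x.coord (n + 1 + j) := fun n j => by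
    change x.coord (n + j + 1) = _
    congr 1; ring
  refine ⟨fun n => h1 (n + 1), fun n => h2 (n + 1), fun n k hk hx j hj hjk => ?_,
    fun n hx j hj => ?_⟩
  · rw [e]; exact h3 (n + 1) k hk hx j hj hjk
  · rw [e]; exact h4 (n + 1) hx j hj

/-- The map `f = σ|_X : X → X`. -/
def exampleMap (s : ℕ → ℝ) : exampleSet s → exampleSet s :=
  (shift_mapsTo s).restrict SeqSpace.shift (exampleSet s) (exampleSet s)

/-- `X_k = X ∩ {-s_k, s_k}^ℤ`. -/
def levelSet (s : ℕ → ℝ) (k : ℕ) : Set (exampleSet s) :=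
  {x | ∀ n : ℤ, x.1.coord n = -s k ∨ x.1.coord n = s k}

/-- `X_∞ = X ∩ {-1, 1}^ℤ`. -/
def limitSet (s : ℕ → ℝ) : Set (exampleSet s) :=
  {x | ∀ n : ℤ, x.1.coord n = -1 ∨ x.1.coord n = 1}

end TopDyn

open TopDyn

namespace TopDyn

/-! ### The sequence space -/

namespace SeqSpace

/-! The moduli $|x_n|$ are the levels of a point. They increase along the sequence, and at level
$s_k$ the positive letters are more than $k$ apart. The main tool is truncation to $[-s_K,s_K]$
(`clamp`). It is 1-Lipschitz, takes finitely many values on the alphabet, moves letters by at most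
$1-s_K$ and preserves legality (`Legal.clamp`). Hence truncated letters of a fine pseudo orbit are
shifted exactly (`exists_clamp_step`).

Chains: since truncation detects level $K$ and moduli increase, a fine chain never loses a level,
however long it is. So $x\to y$ forces $|x_{n+1}|\le|y_n|$, and chain recurrent points have constant
modulus. Points of equal constant modulus are joined by splicing. Leaving $X_k$ for level $1$ is
possible, while near $X_\infty$ there is nowhere else to go, so only $X_\infty$ is terminal.

Shadowing: truncated legal sequences obey a rule of memory $K$, so they behave like a shift of
finite type, and the truncated letters of a pseudo orbit glue to a legal sequence. This works for
every admissible $s$.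

Entropy: in $X_k$ positive letters may be placed freely at sparse positions, so $X_k$ has positive
entropy. As $k\to\infty$ these points approach $z^{(m)}$ and $z$, making them an entropy pair. But
close to $X_\infty$ the points have level at least $s_M$ with $M$ large. At a fixed scale only signs
matter, and a block of length $M$ has at most $M+1$ sign patterns, so the growth rate is of order
$\log(M+1)/M\to0$. No uniform bound $b>0$ survives. -/

theorem abs_coord_le_one (x : SeqSpace) (n : ℤ) : |x.coord n| ≤ 1 := abs_le.2 (x n).2

theorem weighted_le_dist (x y : SeqSpace) (n : ℤ) :
    (1 / 2 : ℝ) ^ n.natAbs * |x.coord n - y.coord n| ≤ dist x y :=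
  le_ciSup (bddAbove_term x y) n

theorem abs_coord_sub_le (x y : SeqSpace) (n : ℤ) :
    |x.coord n - y.coord n| ≤ 2 ^ n.natAbs * dist x y := by
  have h := weighted_le_dist x y n
  have h2 : (2 : ℝ) ^ n.natAbs * (1 / 2 : ℝ) ^ n.natAbs = 1 := by
    rw [← mul_pow]; norm_num
  calc |x.coord n - y.coord n|
      = 2 ^ n.natAbs * ((1 / 2 : ℝ) ^ n.natAbs * |x.coord n - y.coord n|) := by
        rw [← mul_assoc, h2, one_mul]
    _ ≤ _ := by gcongr

theorem abs_coord_sub_le_of_natAbs_le (x y : SeqSpace) {n : ℤ} {N : ℕ} (h : n.natAbs ≤ N) :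
    |x.coord n - y.coord n| ≤ 2 ^ N * dist x y :=
  (abs_coord_sub_le x y n).trans
    (mul_le_mul_of_nonneg_right (pow_le_pow_right₀ (by norm_num) h) dist_nonneg)

/-- Outside the window the letters differ by at most $2$ and carry weight at most $2^{-N}$. -/
theorem dist_le_of_window {x y : SeqSpace} {N : ℕ} {ε : ℝ} (hε : 2 * (1 / 2 : ℝ) ^ N ≤ ε)
    (h : ∀ n : ℤ, n.natAbs ≤ N → |x.coord n - y.coord n| ≤ ε) : dist x y ≤ ε := by
  refine ciSup_le fun n => ?_
  rcases le_total n.natAbs N with hn | hn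
  · calc (1 / 2 : ℝ) ^ n.natAbs * |x.coord n - y.coord n| ≤ 1 * ε :=
        mul_le_mul (pow_le_one₀ (by norm_num) (by norm_num)) (h n hn) (abs_nonneg _) zero_le_one
      _ = ε := one_mul _
  · have h1 : |x.coord n - y.coord n| ≤ 2 :=
      (abs_sub _ _).trans (by linarith [abs_coord_le_one x n, abs_coord_le_one y n])
    calc (1 / 2 : ℝ) ^ n.natAbs * |x.coord n - y.coord n| ≤ (1 / 2 : ℝ) ^ N * 2 :=
        mul_le_mul (pow_le_pow_of_le_one (by norm_num) (by norm_num) hn) h1 (abs_nonneg _)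
          (by positivity)
      _ ≤ ε := by linarith

theorem exists_window {ε : ℝ} (hε : 0 < ε) : ∃ N : ℕ, 2 * (1 / 2 : ℝ) ^ N ≤ ε := by
  obtain ⟨N, hN⟩ := exists_pow_lt_of_lt_one (half_pos hε) (show (1 / 2 : ℝ) < 1 by norm_num)
  exact ⟨N, by linarith⟩

theorem continuous_coord (n : ℤ) : Continuous fun x : SeqSpace => x.coord n := by
  refine (LipschitzWith.of_dist_le_mul (K := 2 ^ n.natAbs) fun x y => ?_).continuous
  simpa [Real.dist_eq] using abs_coord_sub_le x y n

theorem dist_shift_le (x y : SeqSpace) : dist x.shift y.shift ≤ 2 * dist x y := by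
  refine ciSup_le fun n => ?_
  have h := weighted_le_dist x y (n + 1)
  have h1 : (1 / 2 : ℝ) ^ n.natAbs ≤ 2 * (1 / 2 : ℝ) ^ (n + 1).natAbs := by
    have h2 : (1 / 2 : ℝ) ^ (n.natAbs + 1) ≤ (1 / 2 : ℝ) ^ (n + 1).natAbs :=
      pow_le_pow_of_le_one (by norm_num) (by norm_num) (by omega)
    rw [pow_succ] at h2
    linarith
  calc (1 / 2 : ℝ) ^ n.natAbs * |x.coord (n + 1) - y.coord (n + 1)|
      ≤ 2 * (1 / 2 : ℝ) ^ (n + 1).natAbs * |x.coord (n + 1) - y.coord (n + 1)| := by gcongr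
    _ ≤ 2 * dist x y := by rw [mul_assoc]; gcongr

theorem continuous_shift : Continuous shift :=
  (LipschitzWith.of_dist_le_mul (K := 2) dist_shift_le).continuous

theorem exists_coord_eq {g : ℤ → ℝ} (h : ∀ n, |g n| ≤ 1) : ∃ x : SeqSpace, ∀ n, x.coord n = g n :=
  ⟨fun n => ⟨g n, abs_le.1 (h n)⟩, fun _ => rfl⟩

instance : CompactSpace SeqSpace := by
  -- The identity from the compact product topology to the metric topology is continuous, because
  -- finitely many coordinates control the distance up to `ε / 2`.
  let F : (ℤ → Set.Icc (-1 : ℝ) 1) → SeqSpace := fun x => x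
  have hF : Continuous F := by
    rw [continuous_iff_continuousAt]
    intro x
    rw [ContinuousAt, Metric.tendsto_nhds]
    intro ε hε
    obtain ⟨N, hN⟩ := exists_window (half_pos hε)
    have h : ∀ᶠ y in 𝓝 x, ∀ n ∈ Finset.Icc (-(N : ℤ)) N, dist (y n) (x n) < ε / 2 := by
      rw [Finset.eventually_all]
      exact fun n _ => (continuous_apply n).continuousAt.eventually
        (Metric.ball_mem_nhds (x n) (half_pos hε))
    filter_upwards [h] with y hy
    have : dist (F y) (F x) ≤ ε / 2 :=
      dist_le_of_window hN fun n hn => (hy n (Finset.mem_Icc.2 (by omega))).le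
    linarith
  exact Function.Surjective.compactSpace hF fun x => ⟨x, rfl⟩

end SeqSpace

/-! ### The alphabet -/

section Alphabet

variable {s : ℕ → ℝ}

theorem IsAdmissible.lt_of_lt (hs : IsAdmissible s) {i j : ℕ} (hi : 1 ≤ i) (hij : i < j) :
    s i < s j := by
  induction j, hij using Nat.le_induction with
  | base => exact hs.2.1 i hi
  | succ j hj ih => exact ih.trans (hs.2.1 j (by omega))

theorem IsAdmissible.le_of_le (hs : IsAdmissible s) {i j : ℕ} (hi : 1 ≤ i) (hij : i ≤ j) :
    s i ≤ s j := by
  rcases hij.eq_or_lt with rfl | h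
  · exact le_rfl
  · exact (hs.lt_of_lt hi h).le

theorem IsAdmissible.le_of_le_val (hs : IsAdmissible s) {i j : ℕ} (hj : 1 ≤ j) (h : s i ≤ s j) :
    i ≤ j := by
  by_contra! hij
  exact absurd (hs.lt_of_lt hj hij) h.not_gt

theorem IsAdmissible.pos (hs : IsAdmissible s) {k : ℕ} (hk : 1 ≤ k) : 0 < s k :=
  hs.1.trans_le (hs.le_of_le le_rfl hk)

theorem IsAdmissible.le_one (hs : IsAdmissible s) {k : ℕ} (hk : 1 ≤ k) : s k ≤ 1 :=
  ge_of_tendsto hs.2.2 <| (eventually_ge_atTop k).mono fun _ h => hs.le_of_le hk h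

theorem IsAdmissible.lt_one (hs : IsAdmissible s) {k : ℕ} (hk : 1 ≤ k) : s k < 1 :=
  (hs.2.1 k hk).trans_le (hs.le_one (by omega))

theorem IsAdmissible.exists_one_sub_le (hs : IsAdmissible s) (m : ℕ) {ε : ℝ} (hε : 0 < ε) :
    ∃ k, 1 ≤ k ∧ m ≤ k ∧ 1 - s k ≤ ε := by
  have h := hs.2.2.eventually (lt_mem_nhds (show 1 - ε < 1 by linarith))
  obtain ⟨k, hk, hk1, hkm⟩ :=
    (h.and ((eventually_ge_atTop 1).and (eventually_ge_atTop m))).exists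
  exact ⟨k, hk1, hkm, by linarith⟩

theorem mem_alphabet_iff (hs : IsAdmissible s) {t : ℝ} :
    t ∈ alphabet s ↔ |t| = 1 ∨ ∃ k, 1 ≤ k ∧ |t| = s k := by
  simp only [alphabet, mem_union, mem_insert_iff, mem_singleton_iff, mem_ofPred_eq]
  constructor
  · rintro (((rfl | rfl) | ⟨k, hk, rfl⟩) | ⟨k, hk, rfl⟩)
    · simp
    · simp
    · exact Or.inr ⟨k, hk, by rw [abs_neg, abs_of_pos (hs.pos hk)]⟩
    · exact Or.inr ⟨k, hk, abs_of_pos (hs.pos hk)⟩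
  · rintro (h | ⟨k, hk, h⟩)
    · rcases eq_or_eq_neg_of_abs_eq h with rfl | rfl <;> simp
    · rcases eq_or_eq_neg_of_abs_eq h with h | h
      · exact Or.inr ⟨k, hk, h⟩
      · exact Or.inl (Or.inr ⟨k, hk, h⟩)

theorem abs_le_one_of_mem_alphabet (hs : IsAdmissible s) {t : ℝ} (ht : t ∈ alphabet s) :
    |t| ≤ 1 := by
  rcases (mem_alphabet_iff hs).1 ht with h | ⟨k, hk, h⟩
  · exact h.le
  · exact h.trans_le (hs.le_one hk)

theorem isClosed_alphabet (hs : IsAdmissible s) : IsClosed (alphabet s) := by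
  have h : alphabet s = (fun t => |t|) ⁻¹' insert 1 (range fun k => s (k + 1)) := by
    ext t
    rw [mem_alphabet_iff hs]
    simp only [mem_preimage, mem_insert_iff, mem_range]
    refine or_congr Iff.rfl ⟨?_, ?_⟩
    · rintro ⟨k, hk, h⟩
      exact ⟨k - 1, by rw [h, Nat.sub_add_cancel hk]⟩
    · rintro ⟨k, h⟩
      exact ⟨k + 1, by omega, h.symm⟩
  rw [h]
  exact (((tendsto_add_atTop_iff_nat 1).2 hs.2.2).isCompact_insert_range.isClosed).preimage
    continuous_abs

/-- If every level `s k` below `t` is below `u`, then `t ≤ u` (for `t` a modulus of a letter). -/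
theorem abs_le_of_forall_level (hs : IsAdmissible s) {t u : ℝ} (ht : t ∈ alphabet s)
    (h : ∀ k, 1 ≤ k → s k ≤ |t| → s k ≤ u) : |t| ≤ u := by
  rcases (mem_alphabet_iff hs).1 ht with h1 | ⟨k, hk, h1⟩
  · rw [h1]
    exact le_of_tendsto hs.2.2 <| (eventually_ge_atTop 1).mono fun k hk =>
      h k hk ((hs.le_one hk).trans_eq h1.symm)
  · rw [h1]
    exact h k hk h1.ge

/-- Truncation of a real number to `[-c, c]`. -/
noncomputable def clamp (c t : ℝ) : ℝ := max (-c) (min c t)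

theorem abs_clamp {c t : ℝ} (hc : 0 < c) : |clamp c t| = min c |t| := by
  unfold clamp
  rcases le_total 0 t with h | h
  · have : 0 ≤ min c t := le_min hc.le h
    rw [abs_of_nonneg h, max_eq_right (by linarith), abs_of_nonneg this]
  · rw [abs_of_nonpos h, min_eq_right (h.trans hc.le), abs_of_nonpos (max_le (by linarith) h),
      ← min_neg_neg, neg_neg]

theorem abs_clamp_sub_clamp_le (c t u : ℝ) : |clamp c t - clamp c u| ≤ |t - u| :=
  ((abs_max_sub_max_le_max _ _ _ _).trans (by simp)).trans
    ((abs_min_sub_min_le_max c t c u).trans (by simp))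

theorem clamp_neg {c : ℝ} (hc : 0 < c) (t : ℝ) : clamp c (-t) = -clamp c t := by
  unfold clamp
  rcases le_total c t with h | h <;> rcases le_total (-c) t with h' | h' <;>
    simp only [max_def, min_def] <;> split_ifs <;> linarith

theorem abs_clamp_sub_self_le {c t : ℝ} (hc : 0 < c) (hc1 : c ≤ 1) (ht : |t| ≤ 1) :
    |clamp c t - t| ≤ 1 - c := by
  rw [abs_le] at ht
  unfold clamp
  rcases le_total t (-c) with h | h
  · rw [min_eq_right (by linarith), max_eq_left h, abs_of_nonneg (by linarith)]
    linarith
  · rcases le_total c t with h' | h'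
    · rw [min_eq_left h', max_eq_right (by linarith), abs_of_nonpos (by linarith)]
      linarith
    · rw [min_eq_right h', max_eq_right h, sub_self, abs_zero]
      linarith

theorem abs_clamp_mem (hs : IsAdmissible s) {K : ℕ} (hK : 1 ≤ K) {t : ℝ} (ht : t ∈ alphabet s) :
    ∃ k, 1 ≤ k ∧ k ≤ K ∧ |clamp (s K) t| = s k := by
  rw [abs_clamp (hs.pos hK)]
  rcases (mem_alphabet_iff hs).1 ht with h | ⟨k, hk, h⟩ <;> rw [h]
  · exact ⟨K, hK, le_rfl, min_eq_left (hs.le_one hK)⟩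
  · rcases le_total k K with hkK | hkK
    · exact ⟨k, hk, hkK, min_eq_right (hs.le_of_le hk hkK)⟩
    · exact ⟨K, hK, le_rfl, min_eq_left (hs.le_of_le hK hkK)⟩

theorem clamp_mem_alphabet (hs : IsAdmissible s) {K : ℕ} (hK : 1 ≤ K) {t : ℝ}
    (ht : t ∈ alphabet s) : clamp (s K) t ∈ alphabet s := by
  obtain ⟨k, hk, -, h⟩ := abs_clamp_mem hs hK ht
  exact (mem_alphabet_iff hs).2 (Or.inr ⟨k, hk, h⟩)

/-- Letters that are sufficiently close have the same truncation at a given level. -/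
theorem exists_gap (hs : IsAdmissible s) {K : ℕ} (hK : 1 ≤ K) :
    ∃ g : ℝ, 0 < g ∧ ∀ t ∈ alphabet s, ∀ u ∈ alphabet s, |t - u| < g →
      clamp (s K) t = clamp (s K) u := by
  -- Only the letters $\pm s_1,\dots,\pm s_K$ survive truncation. Finitely many values are uniformly
  -- separated, and truncation does not increase distances.
  have hfin : (clamp (s K) '' alphabet s).Finite := by
    refine (((Set.finite_Icc 1 K).image s).union
      ((Set.finite_Icc 1 K).image fun k => -s k)).subset ?_
    rintro _ ⟨t, ht, rfl⟩
    obtain ⟨k, hk, hkK, h⟩ := abs_clamp_mem hs hK ht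
    rcases eq_or_eq_neg_of_abs_eq h with h | h
    · exact Or.inl ⟨k, ⟨hk, hkK⟩, h.symm⟩
    · exact Or.inr ⟨k, ⟨hk, hkK⟩, h.symm⟩
  have : Finite (clamp (s K) '' alphabet s) := hfin
  obtain ⟨C, hC, h⟩ := Set.relatively_discrete_of_finite (s := clamp (s K) '' alphabet s)
  obtain ⟨g, hg, hgC⟩ := ENNReal.lt_iff_exists_nnreal_btwn.1 hC
  refine ⟨g, by exact_mod_cast hg, fun t ht u hu htu => ?_⟩
  by_contra hne
  have h1 := h _ ⟨t, ht, rfl⟩ _ ⟨u, hu, rfl⟩ hne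
  have h2 : edist (clamp (s K) t) (clamp (s K) u) < g := by
    rw [edist_lt_coe, ← NNReal.coe_lt_coe, coe_nndist, Real.dist_eq]
    exact (abs_clamp_sub_clamp_le _ _ _).trans_lt htu
  exact absurd (h1.trans_lt (h2.trans hgC)) (lt_irrefl _)

/-- Truncating at $s_K$ loses no information about whether level $K$ is reached. -/
theorem level_le_iff_clamp (hs : IsAdmissible s) {K : ℕ} (hK : 1 ≤ K) (t : ℝ) :
    s K ≤ t ↔ s K ≤ clamp (s K) t := by
  have := hs.pos hK
  simp [clamp, this]

theorem level_le_abs_iff_clamp (hs : IsAdmissible s) {K : ℕ} (hK : 1 ≤ K) (t : ℝ) :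
    s K ≤ |t| ↔ s K ≤ |clamp (s K) t| := by
  rw [abs_clamp (hs.pos hK)]; simp

end Alphabet

/-! ### Legal sequences -/

section Legal

variable {s : ℕ → ℝ}

/-- The sequences that occur as the coordinates of points of the example. -/
structure Legal (s : ℕ → ℝ) (g : ℤ → ℝ) : Prop where
  mem : ∀ n, g n ∈ alphabet s
  mono : ∀ n, |g n| ≤ |g (n + 1)|
  neg : ∀ (n : ℤ) (k : ℕ), 1 ≤ k → s k ≤ g n → g (n + k) = -g n

theorem Legal.abs_le_abs {g : ℤ → ℝ} (h : Legal s g) {m n : ℤ} (hmn : m ≤ n) : |g m| ≤ |g n| := by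
  induction n, hmn using Int.leInduction with
  | base => exact le_rfl
  | succ n _ ih => exact ih.trans (h.mono n)

theorem Legal.neg_of_le (hs : IsAdmissible s) {g : ℤ → ℝ} (h : Legal s g) {n : ℤ} {j k : ℕ}
    (hj : 1 ≤ j) (hjk : j ≤ k) (hn : s k ≤ g n) : g (n + j) = -g n :=
  h.neg n j hj ((hs.le_of_le hj hjk).trans hn)

/-- The rules for the letters $s_k$ and $1$ merge into the one inequality-based rule `Legal.neg`: a
letter $s_j$ satisfies $s_k\le s_j$ exactly when $k\le j$, and the letter $1$ exceeds every $s_k$.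
This form is the one that passes through truncation. -/
theorem mem_exampleSet_iff (hs : IsAdmissible s) {x : SeqSpace} :
    x ∈ exampleSet s ↔ Legal s x.coord := by
  constructor
  · rintro ⟨h1, h2, h3, h4⟩
    refine ⟨h1, h2, fun n k hk hn => ?_⟩
    have hpos : 0 < x.coord n := (hs.pos hk).trans_le hn
    rcases (mem_alphabet_iff hs).1 (h1 n) with h | ⟨j, hj, h⟩ <;> rw [abs_of_pos hpos] at h
    · rw [h4 n h k hk, h]
    · rw [h3 n j hj h k hk (hs.le_of_le_val hj (h ▸ hn)), h]
  · intro h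
    refine ⟨h.mem, h.mono, fun n k hk hn j hj hjk => ?_, fun n hn j hj => ?_⟩
    · rw [h.neg_of_le hs hj hjk hn.ge, hn]
    · rw [h.neg n j hj (by rw [hn]; exact hs.le_one hj), hn]

theorem legal_coord (hs : IsAdmissible s) (x : exampleSet s) : Legal s x.1.coord :=
  (mem_exampleSet_iff hs).1 x.2

theorem Legal.exists_point (hs : IsAdmissible s) {g : ℤ → ℝ} (h : Legal s g) :
    ∃ x : exampleSet s, ∀ n, x.1.coord n = g n := by
  obtain ⟨x, hx⟩ := SeqSpace.exists_coord_eq fun n => abs_le_one_of_mem_alphabet hs (h.mem n)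
  refine ⟨⟨x, (mem_exampleSet_iff hs).2 ?_⟩, hx⟩
  rwa [show x.coord = g from funext hx]

/-- A truncated letter that is at least $s_k>0$ comes from a letter at least $s_k$, and truncation
is odd, so the sign rule is inherited. -/
theorem Legal.clamp (hs : IsAdmissible s) {K : ℕ} (hK : 1 ≤ K) {g : ℤ → ℝ} (h : Legal s g) :
    Legal s fun n => clamp (s K) (g n) := by
  refine ⟨fun n => clamp_mem_alphabet hs hK (h.mem n), fun n => ?_, fun n k hk hn => ?_⟩
  · simp only [abs_clamp (hs.pos hK)]
    exact min_le_min_left _ (h.mono n)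
  · have hg : s k ≤ g n := by
      rcases le_max_iff.1 hn with h | h
      · linarith [hs.pos hk, hs.pos hK]
      · exact h.trans (min_le_right _ _)
    simp only [h.neg n k hk hg, clamp_neg (hs.pos hK)]

/-- A sequence of constant modulus `s k` is legal if its positive entries have gaps larger than
`k`. -/
theorem legal_of_level (hs : IsAdmissible s) {k : ℕ} (hk : 1 ≤ k) {g : ℤ → ℝ}
    (h : ∀ n, g n = -s k ∨ g n = s k)
    (hgap : ∀ (n : ℤ) (j : ℕ), 1 ≤ j → j ≤ k → g n = s k → g (n + j) = -s k) : Legal s g := by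
  have habs : ∀ n, |g n| = s k := fun n => by
    rcases h n with h | h <;> simp [h, abs_of_pos (hs.pos hk)]
  refine ⟨fun n => (mem_alphabet_iff hs).2 (Or.inr ⟨k, hk, habs n⟩),
    fun n => by rw [habs, habs], fun n j hj hn => ?_⟩
  rcases h n with h' | h'
  · linarith [hs.pos hj, hs.pos hk]
  · rw [h']
    exact hgap n j hj (hs.le_of_le_val hk (h' ▸ hn)) h'

theorem isClosed_exampleSet (hs : IsAdmissible s) : IsClosed (exampleSet s) := by
  have hc := SeqSpace.continuous_coord
  choose g hg hgap using fun k : {k : ℕ // 1 ≤ k} => exists_gap hs k.2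
  -- No letter lies strictly between `s k - g k` and `s k`. So the closed premise `s k ≤ x.coord n`
  -- may be replaced by an open one, and the implication becomes a union of two closed conditions.
  have h : exampleSet s = (⋂ n, {x | x.coord n ∈ alphabet s}) ∩
      ((⋂ n, {x | |x.coord n| ≤ |x.coord (n + 1)|}) ∩
      ⋂ (n : ℤ) (k : {k : ℕ // 1 ≤ k}),
        ({x | x.coord n ≤ s k - g k} ∪ {x | x.coord (n + k) = -x.coord n})) := by
    ext x
    rw [mem_exampleSet_iff hs]
    simp only [mem_inter_iff, mem_iInter, mem_union, mem_ofPred_eq]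
    constructor
    · intro h
      refine ⟨h.mem, h.mono, fun n k => ?_⟩
      by_cases hn : s k ≤ x.coord n
      · exact Or.inr (h.neg n k k.2 hn)
      · refine Or.inl (le_of_not_gt fun hlt => hn ?_)
        have := hgap k (x.coord n) (h.mem n) (s k)
          ((mem_alphabet_iff hs).2 (Or.inr ⟨k, k.2, abs_of_pos (hs.pos k.2)⟩))
          (abs_lt.2 ⟨by linarith, by linarith [hg k]⟩)
        rw [level_le_iff_clamp hs k.2, this, ← level_le_iff_clamp hs k.2]
    · rintro ⟨h1, h2, h3⟩
      refine ⟨h1, h2, fun n k hk hn => (h3 n ⟨k, hk⟩).resolve_left fun h => ?_⟩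
      have := hg ⟨k, hk⟩
      simp only at h
      linarith
  rw [h]
  refine (isClosed_iInter fun n => (isClosed_alphabet hs).preimage (hc n)).inter
    ((isClosed_iInter fun n => isClosed_le (hc n).abs (hc _).abs).inter
      (isClosed_iInter fun n => isClosed_iInter fun k => ?_))
  exact (isClosed_le (hc n) continuous_const).union (isClosed_eq (hc _) (hc n).neg)

theorem compactSpace_exampleSet (hs : IsAdmissible s) : CompactSpace (exampleSet s) :=
  isCompact_iff_compactSpace.1 (isClosed_exampleSet hs).isCompact

theorem exampleMap_coord (x : exampleSet s) (n : ℤ) :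
    (exampleMap s x).1.coord n = x.1.coord (n + 1) := rfl

theorem iterate_coord (i : ℕ) (x : exampleSet s) (n : ℤ) :
    ((exampleMap s)^[i] x).1.coord n = x.1.coord (n + i) := by
  induction i generalizing x with
  | zero => simp
  | succ i ih =>
    rw [Function.iterate_succ_apply, ih, exampleMap_coord]
    congr 1; push_cast; ring

theorem continuous_exampleMap (s : ℕ → ℝ) : Continuous (exampleMap s) :=
  (SeqSpace.continuous_shift.comp continuous_subtype_val).subtype_mk _

theorem exampleSet_ext {x y : exampleSet s} (h : ∀ n, x.1.coord n = y.1.coord n) : x = y :=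
  Subtype.ext (SeqSpace.ext_coord h)

theorem Legal.translate {g : ℤ → ℝ} (h : Legal s g) (m : ℤ) : Legal s fun n => g (n + m) := by
  refine ⟨fun n => h.mem _, fun n => ?_, fun n k hk hn => ?_⟩
  · rw [add_right_comm]; exact h.mono _
  · rw [add_right_comm]; exact h.neg _ k hk hn

/-- Every point can be translated, by any integer. -/
theorem exists_translate (hs : IsAdmissible s) (x : exampleSet s) (m : ℤ) :
    ∃ y : exampleSet s, ∀ n, y.1.coord n = x.1.coord (n + m) :=
  ((legal_coord hs x).translate m).exists_point hs

theorem isHomeomorph_exampleMap (hs : IsAdmissible s) : IsHomeomorph (exampleMap s) := by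
  have := compactSpace_exampleSet hs
  refine isHomeomorph_iff_continuous_bijective.2 ⟨continuous_exampleMap s, fun x y h => ?_,
    fun x => ?_⟩
  · refine exampleSet_ext fun n => ?_
    have := exampleMap_coord x (n - 1)
    rw [h, exampleMap_coord] at this
    simpa using this.symm
  · obtain ⟨y, hy⟩ := exists_translate hs x (-1)
    exact ⟨y, exampleSet_ext fun n => by rw [exampleMap_coord, hy]; simp⟩

end Legal

/-! ### Chains -/

/-- Two points that are joined by a true orbit segment up to small errors at both ends are joined
by chains. -/
theorem ChainsTo.of_approx {X : Type*} [MetricSpace X] {f : X → X} (hf : Continuous f) {x y : X}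
    (h : ∀ ε : ℝ, 0 < ε → ∃ (w : X) (m : ℕ), 1 ≤ m ∧ dist w x ≤ ε ∧ dist (f^[m] w) y ≤ ε) :
    ChainsTo f x y := by
  intro δ hδ
  obtain ⟨η, hη, hfη⟩ := Metric.continuousAt_iff.1 (hf.continuousAt (x := x)) (δ / 2) (half_pos hδ)
  obtain ⟨w, m, hm, hw, hwy⟩ := h (min (η / 2) (δ / 2)) (by positivity)
  have h1 : dist (f x) (f w) < δ / 2 := by
    rw [dist_comm]
    exact hfη (by linarith [min_le_left (η / 2) (δ / 2)])
  have h2 : dist (f^[m] w) y ≤ δ / 2 := hwy.trans (min_le_right _ _)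
  refine ⟨m, fun i => if i = 0 then x else if m ≤ i then y else f^[i] w, ⟨hm, fun i hi => ?_⟩,
    by simp, by simp [show m ≠ 0 by omega]⟩
  by_cases hi0 : i = 0
  · subst hi0
    -- For `m = 1` both errors fall into the same step, hence the two halves of `δ`.
    by_cases hm1 : m ≤ 1
    · obtain rfl : m = 1 := by omega
      simp only [if_true, zero_add, one_ne_zero, if_false, le_refl]
      have := dist_triangle (f x) (f w) y
      simp only [Function.iterate_one] at h2
      linarith
    · simp [hm1]
      linarith
  · by_cases hmi : m ≤ i + 1
    · obtain rfl : m = i + 1 := by omega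
      simp only [hi0, if_false, Nat.succ_ne_zero, le_refl, if_true, Nat.not_succ_le_self,
        ← Function.iterate_succ_apply' f]
      linarith
    · simp only [hi0, if_false, Nat.succ_ne_zero, hmi, show ¬ m ≤ i by omega,
        ← Function.iterate_succ_apply' f, dist_self]
      exact hδ.le

theorem ChainsTo.trans {X : Type*} [MetricSpace X] {f : X → X} {x y z : X} (h : ChainsTo f x y)
    (h' : ChainsTo f y z) : ChainsTo f x z := by
  intro δ hδ
  obtain ⟨k, c, ⟨hk, hc⟩, hc0, hck⟩ := h δ hδ
  obtain ⟨k', c', ⟨hk', hc'⟩, hc0', hck'⟩ := h' δ hδ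
  refine ⟨k + k', fun i => if i < k then c i else c' (i - k), ⟨by omega, fun i hi => ?_⟩,
    by simp [hk, hc0], by simp [hck']⟩
  by_cases h1 : i + 1 < k
  · simpa [h1, show i < k by omega] using hc i (by omega)
  · by_cases h2 : i < k
    · obtain rfl : k = i + 1 := by omega
      simpa [hc0', ← hck] using hc i h2
    · simpa [h1, h2, show i + 1 - k = i - k + 1 by omega] using hc' (i - k) (by omega)

section Example

variable {s : ℕ → ℝ}

/-- Along fine pseudo orbits the truncated coordinates in a window are shifted exactly. -/
theorem exists_clamp_step (hs : IsAdmissible s) {K : ℕ} (hK : 1 ≤ K) (N : ℕ) :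
    ∃ δ : ℝ, 0 < δ ∧ ∀ x y : exampleSet s, dist (exampleMap s x) y ≤ δ → ∀ n : ℤ, n.natAbs ≤ N →
      clamp (s K) (y.1.coord n) = clamp (s K) (x.1.coord (n + 1)) := by
  obtain ⟨g, hg, hgap⟩ := exists_gap hs hK
  refine ⟨g / 2 / 2 ^ N, by positivity, fun x y hxy n hn => Eq.symm ?_⟩
  refine hgap _ ((legal_coord hs x).mem _) _ ((legal_coord hs y).mem _) ?_
  have h := SeqSpace.abs_coord_sub_le_of_natAbs_le (exampleMap s x).1 y.1 hn
  rw [exampleMap_coord] at h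
  have h2 : 2 ^ N * dist (exampleMap s x).1 y.1 ≤ g / 2 := by
    rw [le_div_iff₀ (by positivity)] at hxy
    rwa [mul_comm]
  linarith

/-- Fine chains do not lose levels. -/
theorem exists_level_le_chain (hs : IsAdmissible s) {k : ℕ} (hk : 1 ≤ k) (n : ℤ) :
    ∃ δ : ℝ, 0 < δ ∧ ∀ (m : ℕ) (c : ℕ → exampleSet s), IsDeltaChain (exampleMap s) δ m c →
      s k ≤ |(c 0).1.coord (n + 1)| → s k ≤ |(c m).1.coord n| := by
  obtain ⟨δ, hδ, h⟩ := exists_clamp_step hs hk n.natAbs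
  refine ⟨δ, hδ, fun m c ⟨hm, hc⟩ h0 => ?_⟩
  have key : ∀ i, i < m → s k ≤ |(c i).1.coord (n + 1)| → s k ≤ |(c (i + 1)).1.coord n| := by
    intro i hi h1
    rw [level_le_abs_iff_clamp hs hk] at h1 ⊢
    rwa [h (c i) (c (i + 1)) (hc i hi) n le_rfl]
  have : ∀ i, i < m → s k ≤ |(c (i + 1)).1.coord n| := by
    intro i
    induction i with
    | zero => exact fun hi => key 0 hi h0
    | succ i ih =>
      -- Monotone moduli carry the level from coordinate `n` back to `n + 1`, where the next step
      -- reads it. Thus `δ` does not depend on the length of the chain.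
      exact fun hi => key _ hi ((ih (by omega)).trans ((legal_coord hs _).mono n))
  obtain ⟨j, rfl⟩ : ∃ j, m = j + 1 := ⟨m - 1, by omega⟩
  exact this j (by omega)

/-- The gain of one index comes from chains having at least one step. With `x = y` it makes the
modulus constant. -/
theorem abs_coord_le_of_chainsTo (hs : IsAdmissible s) {x y : exampleSet s}
    (h : ChainsTo (exampleMap s) x y) (n : ℤ) : |x.1.coord (n + 1)| ≤ |y.1.coord n| := by
  refine abs_le_of_forall_level hs ((legal_coord hs x).mem _) fun k hk hx => ?_
  obtain ⟨δ, hδ, hc⟩ := exists_level_le_chain hs hk n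
  obtain ⟨m, c, hmc, rfl, rfl⟩ := h δ hδ
  exact hc m c hmc hx

theorem abs_coord_mono_of_chainsTo (hs : IsAdmissible s) {x y : exampleSet s}
    (h : ChainsTo (exampleMap s) x y) (n : ℤ) : |x.1.coord n| ≤ |y.1.coord n| :=
  ((legal_coord hs x).mono n).trans (abs_coord_le_of_chainsTo hs h n)

theorem mem_levelSet_iff (hs : IsAdmissible s) {k : ℕ} (hk : 1 ≤ k) {x : exampleSet s} :
    x ∈ levelSet s k ↔ ∀ n, |x.1.coord n| = s k := by
  refine forall_congr' fun n => ?_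
  rw [abs_eq (hs.pos hk).le, or_comm]

theorem mem_limitSet_iff {x : exampleSet s} : x ∈ limitSet s ↔ ∀ n, |x.1.coord n| = 1 := by
  refine forall_congr' fun n => ?_
  rw [abs_eq zero_le_one, or_comm]

theorem abs_eq_of_forall_succ {x : exampleSet s}
    (h : ∀ n : ℤ, |x.1.coord n| = |x.1.coord (n + 1)|) (n : ℤ) :
    |x.1.coord n| = |x.1.coord 0| := by
  induction n using Int.induction_on with
  | zero => rfl
  | succ i ih => rw [← h, ih]
  | pred i ih => rw [← ih, h (-(i : ℤ) - 1), sub_add_cancel]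

theorem constant_modulus_eq_union (hs : IsAdmissible s) :
    {x : exampleSet s | ∀ n : ℤ, |x.1.coord n| = |x.1.coord (n + 1)|} =
      limitSet s ∪ ⋃ (k : ℕ) (_ : 1 ≤ k), levelSet s k := by
  ext x
  simp only [mem_ofPred_eq, mem_union, mem_iUnion, exists_prop]
  constructor
  · intro h
    have h0 := abs_eq_of_forall_succ h
    rcases (mem_alphabet_iff hs).1 ((legal_coord hs x).mem 0) with h1 | ⟨k, hk, h1⟩
    · exact Or.inl (mem_limitSet_iff.2 fun n => (h0 n).trans h1)
    · exact Or.inr ⟨k, hk, (mem_levelSet_iff hs hk).2 fun n => (h0 n).trans h1⟩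
  · rintro (h | ⟨k, hk, h⟩) n
    · rw [mem_limitSet_iff] at h; rw [h, h]
    · rw [mem_levelSet_iff hs hk] at h; rw [h, h]

/-! ### The limit set -/

theorem legal_zPoint (hs : IsAdmissible s) : Legal s SeqSpace.zPoint.coord := by
  have h : ∀ n, SeqSpace.zPoint.coord n = -1 := fun _ => rfl
  refine ⟨fun n => (mem_alphabet_iff hs).2 (Or.inl ?_), fun n => by rw [h, h], fun n k hk hn => ?_⟩
  · rw [h]; simp
  · rw [h] at hn; linarith [hs.pos hk]

theorem zPointAt_coord (m n : ℤ) :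
    (SeqSpace.zPointAt m).coord n = if n = m then 1 else -1 := by
  unfold SeqSpace.coord SeqSpace.zPointAt
  split_ifs <;> rfl

theorem legal_zPointAt (hs : IsAdmissible s) (m : ℤ) : Legal s (SeqSpace.zPointAt m).coord := by
  have habs : ∀ n, |(SeqSpace.zPointAt m).coord n| = 1 := fun n => by
    rw [zPointAt_coord]; split_ifs <;> simp
  refine ⟨fun n => (mem_alphabet_iff hs).2 (Or.inl (habs n)), fun n => by rw [habs, habs],
    fun n k hk hn => ?_⟩
  rw [zPointAt_coord] at hn ⊢
  split_ifs at hn with h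
  · rw [zPointAt_coord, if_neg (by omega), if_pos h]
  · linarith [hs.pos hk]

/-- The fixed point `z` as a point of the example. -/
def zPt (hs : IsAdmissible s) : exampleSet s :=
  ⟨SeqSpace.zPoint, (mem_exampleSet_iff hs).2 (legal_zPoint hs)⟩

/-- The point `z^{(m)}` as a point of the example. -/
def zPtAt (hs : IsAdmissible s) (m : ℤ) : exampleSet s :=
  ⟨SeqSpace.zPointAt m, (mem_exampleSet_iff hs).2 (legal_zPointAt hs m)⟩

theorem zPt_coord (hs : IsAdmissible s) (n : ℤ) : (zPt hs).1.coord n = -1 := rfl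

theorem zPtAt_coord (hs : IsAdmissible s) (m n : ℤ) :
    (zPtAt hs m).1.coord n = if n = m then 1 else -1 := zPointAt_coord m n

theorem zPt_mem (hs : IsAdmissible s) : zPt hs ∈ limitSet s := fun _ => Or.inl rfl

theorem zPtAt_mem (hs : IsAdmissible s) (m : ℤ) : zPtAt hs m ∈ limitSet s := fun n => by
  rw [zPtAt_coord]; split_ifs <;> simp

theorem eq_zPt_or_zPtAt (hs : IsAdmissible s) {x : exampleSet s} (hx : x ∈ limitSet s) :
    x = zPt hs ∨ ∃ m, x = zPtAt hs m := by
  by_cases h : ∃ m, x.1.coord m = 1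
  · obtain ⟨m, hm⟩ := h
    have key : ∀ a b : ℤ, a < b → x.1.coord a = 1 → x.1.coord b = -1 := fun a b hab ha => by
      have := x.2.2.2.2 a ha (b - a).toNat (by omega)
      rwa [Int.toNat_of_nonneg (by omega), add_sub_cancel] at this
    refine Or.inr ⟨m, exampleSet_ext fun n => ?_⟩
    rw [zPtAt_coord]
    split_ifs with hn
    · rw [hn, hm]
    · refine (hx n).resolve_right fun h1 => ?_
      rcases lt_or_gt_of_ne hn with hlt | hlt
      · have := key n m hlt h1
        linarith
      · have := key m n hlt hm
        linarith
  · exact Or.inl (exampleSet_ext fun n => (hx n).resolve_right fun hn => h ⟨n, hn⟩)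

theorem image_limitSet (hs : IsAdmissible s) :
    Subtype.val '' limitSet s = {SeqSpace.zPoint} ∪ Set.range SeqSpace.zPointAt := by
  ext x
  constructor
  · rintro ⟨y, hy, rfl⟩
    rcases eq_zPt_or_zPtAt hs hy with rfl | ⟨m, rfl⟩
    · exact Or.inl rfl
    · exact Or.inr ⟨m, rfl⟩
  · rintro (rfl | ⟨m, rfl⟩)
    · exact ⟨_, zPt_mem hs, rfl⟩
    · exact ⟨_, zPtAt_mem hs m, rfl⟩

theorem infinite_limitSet (hs : IsAdmissible s) : (limitSet s).Infinite := by
  refine Set.infinite_of_injective_forall_mem (f := zPtAt hs) (fun m m' h => ?_) (zPtAt_mem hs)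
  have := zPtAt_coord hs m m
  rw [h, zPtAt_coord] at this
  by_contra hne
  rw [if_neg hne, if_pos rfl] at this
  linarith

/-! ### Chain components -/

/-- Criterion for `x → y` in terms of coordinates in windows. -/
theorem chainsTo_of_window {x y : exampleSet s}
    (h : ∀ N : ℕ, ∃ (w : exampleSet s) (M : ℕ), 1 ≤ M ∧
      (∀ n : ℤ, n.natAbs ≤ N → w.1.coord n = x.1.coord n) ∧
      ∀ n : ℤ, n.natAbs ≤ N → w.1.coord (n + M) = y.1.coord n) :
    ChainsTo (exampleMap s) x y := by
  refine ChainsTo.of_approx (continuous_exampleMap s) fun ε hε => ?_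
  obtain ⟨N, hN⟩ := SeqSpace.exists_window hε
  obtain ⟨w, M, hM, hx, hy⟩ := h N
  refine ⟨w, M, hM, SeqSpace.dist_le_of_window hN fun n hn => ?_,
    SeqSpace.dist_le_of_window hN fun n hn => ?_⟩
  · rw [hx n hn, sub_self, abs_zero]; exact hε.le
  · rw [iterate_coord, hy n hn, sub_self, abs_zero]; exact hε.le

theorem chainsTo_of_mem_levelSet (hs : IsAdmissible s) {k : ℕ} (hk : 1 ≤ k) {x y : exampleSet s}
    (hx : x ∈ levelSet s k) (hy : y ∈ levelSet s k) : ChainsTo (exampleMap s) x y := by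
  have hpos := hs.pos hk
  refine chainsTo_of_window fun N => ?_
  have hgap : ∀ z : exampleSet s, ∀ (n : ℤ) (j : ℕ), 1 ≤ j → j ≤ k → z.1.coord n = s k →
      z.1.coord (n + j) = -s k := fun z n j hj hjk hz => z.2.2.2.1 n k hk hz j hj hjk
  -- Splice `x` up to `N`, then `k` negative letters that keep positive letters more than `k` apart,
  -- then `y` from its coordinate `-N` on. This fixes the shift `2 * N + k + 1`.
  have hleg : Legal s fun n : ℤ => if n ≤ N then x.1.coord n else if n ≤ N + k then -s k else
      y.1.coord (n - (2 * N + k + 1)) := by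
    refine legal_of_level hs hk (fun n => ?_) fun n j hj hjk hn => ?_
    · split_ifs
      exacts [hx n, Or.inl rfl, hy _]
    · by_cases h1 : n ≤ N
      · rw [if_pos h1] at hn
        by_cases h2 : n + j ≤ N
        · rw [if_pos h2, hgap x n j hj hjk hn]
        · rw [if_neg h2, if_pos (by omega)]
      · rw [if_neg h1] at hn
        by_cases h2 : n ≤ N + k
        · rw [if_pos h2] at hn; linarith
        · rw [if_neg h2] at hn
          rw [if_neg (by omega), if_neg (by omega), ← hgap y _ j hj hjk hn]
          congr 1; ring
  obtain ⟨w, hw⟩ := hleg.exists_point hs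
  refine ⟨w, 2 * N + k + 1, by omega, fun n hn => ?_, fun n hn => ?_⟩
  · rw [hw, if_pos (by omega)]
  · rw [hw, if_neg (by push_cast; omega), if_neg (by push_cast; omega)]
    congr 1; push_cast; ring

theorem chainsTo_zPt (hs : IsAdmissible s) {x : exampleSet s} (hx : x ∈ limitSet s) :
    ChainsTo (exampleMap s) x (zPt hs) := by
  refine chainsTo_of_window fun N => ?_
  rcases eq_zPt_or_zPtAt hs hx with rfl | ⟨m, rfl⟩
  · exact ⟨zPt hs, 1, le_rfl, fun n _ => rfl, fun n _ => rfl⟩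
  · refine ⟨zPtAt hs m, N + m.natAbs + 1, by omega, fun n _ => rfl, fun n hn => ?_⟩
    rw [zPtAt_coord, if_neg (by omega), zPt_coord]

theorem zPt_chainsTo (hs : IsAdmissible s) {x : exampleSet s} (hx : x ∈ limitSet s) :
    ChainsTo (exampleMap s) (zPt hs) x := by
  refine chainsTo_of_window fun N => ?_
  rcases eq_zPt_or_zPtAt hs hx with rfl | ⟨m, rfl⟩
  · exact ⟨zPt hs, 1, le_rfl, fun n _ => rfl, fun n _ => rfl⟩
  · refine ⟨zPtAt hs (m + (N + m.natAbs + 1 : ℕ)), N + m.natAbs + 1, by omega, fun n hn => ?_,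
      fun n _ => ?_⟩
    · rw [zPtAt_coord, if_neg (by omega), zPt_coord]
    · rw [zPtAt_coord, zPtAt_coord]
      simp only [add_left_inj]

theorem chainsTo_of_mem_limitSet (hs : IsAdmissible s) {x y : exampleSet s}
    (hx : x ∈ limitSet s) (hy : y ∈ limitSet s) : ChainsTo (exampleMap s) x y :=
  (chainsTo_zPt hs hx).trans (zPt_chainsTo hs hy)

theorem chainRecurrentSet_exampleMap (hs : IsAdmissible s) :
    chainRecurrentSet (exampleMap s) = {x | ∀ n : ℤ, |x.1.coord n| = |x.1.coord (n + 1)|} := by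
  refine Subset.antisymm (fun x hx n => ?_) ?_
  · exact le_antisymm ((legal_coord hs x).mono n) (abs_coord_le_of_chainsTo hs hx n)
  · rw [constant_modulus_eq_union hs]
    rintro x (hx | hx)
    · exact chainsTo_of_mem_limitSet hs hx hx
    · simp only [mem_iUnion] at hx
      obtain ⟨k, hk, hx⟩ := hx
      exact chainsTo_of_mem_levelSet hs hk hx hx

theorem component_eq_limitSet (hs : IsAdmissible s) {x : exampleSet s} (hx : x ∈ limitSet s) :
    {y | y ∈ chainRecurrentSet (exampleMap s) ∧ ChainsTo (exampleMap s) x y ∧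
      ChainsTo (exampleMap s) y x} = limitSet s := by
  ext y
  refine ⟨fun ⟨_, h1, h2⟩ => mem_limitSet_iff.2 fun n => ?_, fun hy => ⟨?_, ?_, ?_⟩⟩
  · rw [← mem_limitSet_iff.1 hx n]
    exact le_antisymm (abs_coord_mono_of_chainsTo hs h2 n) (abs_coord_mono_of_chainsTo hs h1 n)
  all_goals apply chainsTo_of_mem_limitSet hs <;> assumption

theorem component_eq_levelSet (hs : IsAdmissible s) {k : ℕ} (hk : 1 ≤ k) {x : exampleSet s}
    (hx : x ∈ levelSet s k) :
    {y | y ∈ chainRecurrentSet (exampleMap s) ∧ ChainsTo (exampleMap s) x y ∧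
      ChainsTo (exampleMap s) y x} = levelSet s k := by
  ext y
  refine ⟨fun ⟨_, h1, h2⟩ => (mem_levelSet_iff hs hk).2 fun n => ?_, fun hy => ⟨?_, ?_, ?_⟩⟩
  · rw [← (mem_levelSet_iff hs hk).1 hx n]
    exact le_antisymm (abs_coord_mono_of_chainsTo hs h2 n) (abs_coord_mono_of_chainsTo hs h1 n)
  all_goals apply chainsTo_of_mem_levelSet hs hk <;> assumption

theorem exists_constant (hs : IsAdmissible s) {k : ℕ} (hk : 1 ≤ k) :
    ∃ x : exampleSet s, ∀ n, x.1.coord n = -s k := by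
  refine Legal.exists_point hs (legal_of_level hs hk (fun _ => Or.inl rfl) fun _ _ _ _ h => ?_)
  linarith [hs.pos hk]

theorem chainComponents_exampleMap (hs : IsAdmissible s) :
    chainComponents (exampleMap s) =
      {limitSet s} ∪ {C | ∃ k : ℕ, 1 ≤ k ∧ C = levelSet s k} := by
  ext C
  constructor
  · rintro ⟨x, hx, rfl⟩
    rw [chainRecurrentSet_exampleMap hs, constant_modulus_eq_union hs] at hx
    rcases hx with hx | hx
    · exact Or.inl (component_eq_limitSet hs hx)
    · simp only [mem_iUnion] at hx
      obtain ⟨k, hk, hx⟩ := hx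
      exact Or.inr ⟨k, hk, component_eq_levelSet hs hk hx⟩
  · rintro (rfl | ⟨k, hk, rfl⟩)
    · exact ⟨zPt hs, chainsTo_of_mem_limitSet hs (zPt_mem hs) (zPt_mem hs),
        (component_eq_limitSet hs (zPt_mem hs)).symm⟩
    · obtain ⟨x, hx⟩ := exists_constant hs hk
      have hx : x ∈ levelSet s k := fun n => Or.inl (hx n)
      exact ⟨x, chainsTo_of_mem_levelSet hs hk hx hx, (component_eq_levelSet hs hk hx).symm⟩

/-! ### Terminal chain components -/

theorem abs_sub_le_of_same_sign {c t u : ℝ} (ht : c ≤ |t|) (hu : c ≤ |u|)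
    (ht1 : |t| ≤ 1) (hu1 : |u| ≤ 1) (h : 0 < t ↔ 0 < u) : |t - u| ≤ 1 - c := by
  rw [abs_le]
  by_cases h0 : 0 < t
  · rw [abs_of_pos h0] at ht ht1
    rw [abs_of_pos (h.1 h0)] at hu hu1
    constructor <;> linarith
  · have h0' := not_lt.1 (mt h.2 h0)
    rw [abs_of_nonpos (not_lt.1 h0)] at ht ht1
    rw [abs_of_nonpos h0'] at hu hu1
    constructor <;> linarith

theorem Legal.not_pos_of_lt (hs : IsAdmissible s) {g : ℤ → ℝ} (h : Legal s g) {k : ℕ}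
    {a b : ℤ} (ha : s k ≤ g a) (ha0 : 0 < g a) (hab : a < b) (hb : b ≤ a + k) : ¬ 0 < g b := by
  have := h.neg_of_le hs (j := (b - a).toNat) (k := k) (by omega) (by omega) ha
  rw [Int.toNat_of_nonneg (by omega), add_sub_cancel] at this
  linarith

/-- Two positive entries of high level cannot be close to each other. -/
theorem Legal.eq_of_pos (hs : IsAdmissible s) {g : ℤ → ℝ} (h : Legal s g) {k : ℕ}
    {a b : ℤ} (ha : s k ≤ |g a|) (hb : s k ≤ |g b|) (ha0 : 0 < g a) (hb0 : 0 < g b)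
    (hab : b ≤ a + k) (hba : a ≤ b + k) : a = b := by
  rw [abs_of_pos ha0] at ha
  rw [abs_of_pos hb0] at hb
  rcases lt_trichotomy a b with hlt | heq | hlt
  · exact absurd hb0 (h.not_pos_of_lt hs ha ha0 hlt hab)
  · exact heq
  · exact absurd ha0 (h.not_pos_of_lt hs hb hb0 hlt hba)

/-- Points all of whose coordinates in a window have high level are close to the limit set. -/
theorem infDist_limitSet_le (hs : IsAdmissible s) {N k : ℕ} {ε : ℝ} (hk : 1 ≤ k)
    (hNk : 2 * N ≤ k) (hN : 2 * (1 / 2 : ℝ) ^ N ≤ ε) (hε : 1 - s k ≤ ε) {y : exampleSet s}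
    (hy : s k ≤ |y.1.coord (-N)|) : Metric.infDist y (limitSet s) ≤ ε := by
  have hw : ∀ n : ℤ, n.natAbs ≤ N → s k ≤ |y.1.coord n| := fun n hn =>
    hy.trans ((legal_coord hs y).abs_le_abs (by omega))
  -- Since `2 * N ≤ k`, the window holds at most one positive letter, so its sign pattern is that of
  -- $z$ or of some $z^{(m)}$.
  obtain ⟨z, hz, hzy⟩ : ∃ z ∈ limitSet s, ∀ n : ℤ, n.natAbs ≤ N →
      (0 < y.1.coord n ↔ 0 < z.1.coord n) := by
    by_cases h : ∃ m : ℤ, m.natAbs ≤ N ∧ 0 < y.1.coord m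
    · obtain ⟨m, hm, hpos⟩ := h
      refine ⟨zPtAt hs m, zPtAt_mem hs m, fun n hn => ?_⟩
      rw [zPtAt_coord]
      constructor
      · intro h
        rw [if_pos ((legal_coord hs y).eq_of_pos hs (hw n hn) (hw m hm) h hpos (by omega)
          (by omega))]
        exact one_pos
      · split_ifs with hnm
        · intro _; rwa [hnm]
        · intro h; linarith
    · refine ⟨zPt hs, zPt_mem hs, fun n hn => ⟨fun h' => absurd ⟨n, hn, h'⟩ h, fun h' => ?_⟩⟩
      rw [zPt_coord] at h'
      linarith
  refine (Metric.infDist_le_dist_of_mem hz).trans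
    (SeqSpace.dist_le_of_window hN fun n hn => ?_)
  refine (abs_sub_le_of_same_sign (hw n hn) ?_ (SeqSpace.abs_coord_le_one _ _)
    (SeqSpace.abs_coord_le_one _ _) (hzy n hn)).trans hε
  rw [mem_limitSet_iff.1 hz]
  exact hs.le_one hk

theorem isChainStable_limitSet (hs : IsAdmissible s) :
    IsChainStable (exampleMap s) (limitSet s) := by
  refine ⟨?_, fun x hx n => hx (n + 1), fun ε hε => ?_⟩
  · have : limitSet s = ⋂ n, {x : exampleSet s | |x.1.coord n| = 1} := by
      ext x; simp [mem_limitSet_iff]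
    rw [this]
    exact isClosed_iInter fun n => isClosed_eq
      ((SeqSpace.continuous_coord n).comp continuous_subtype_val).abs continuous_const
  · obtain ⟨N, hN⟩ := SeqSpace.exists_window hε
    obtain ⟨k, hk, hkN, hkε⟩ := hs.exists_one_sub_le (2 * N) hε
    obtain ⟨δ, hδ, h⟩ := exists_level_le_chain hs hk (-N)
    refine ⟨δ, hδ, fun m c hmc h0 => infDist_limitSet_le hs hk hkN hN hkε (h m c hmc ?_)⟩
    rw [mem_limitSet_iff.1 h0]
    exact hs.le_one hk

theorem not_isChainStable_levelSet (hs : IsAdmissible s) {k : ℕ} (hk : 1 ≤ k) :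
    ¬ IsChainStable (exampleMap s) (levelSet s k) := by
  have hpos := hs.pos hk
  have hlt := hs.lt_one hk
  rintro ⟨-, -, h⟩
  obtain ⟨x, hx⟩ := exists_constant hs hk
  have hxk : x ∈ levelSet s k := fun n => Or.inl (hx n)
  -- This point is backward asymptotic to the constant point of $X_k$, but its coordinate `0` is at
  -- distance at least $1-s_k$ from the letters $\pm s_k$.
  have hleg : Legal s fun n : ℤ => if n < 0 then -s k else -1 := by
    refine ⟨fun n => (mem_alphabet_iff hs).2 ?_, fun n => ?_, fun n j hj hn => ?_⟩
    · split_ifs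
      · exact Or.inr ⟨k, hk, by rw [abs_neg, abs_of_pos hpos]⟩
      · exact Or.inl (by simp)
    · split_ifs <;> simp only [abs_neg, abs_one, le_refl, abs_of_pos hpos, hlt.le]
      omega
    · have := hs.pos hj
      split_ifs at hn <;> linarith
  obtain ⟨w, hw⟩ := hleg.exists_point hs
  have hxw : ChainsTo (exampleMap s) x w := by
    refine chainsTo_of_window fun N => ?_
    obtain ⟨v, hv⟩ := exists_translate hs w (-(N + 1 : ℕ))
    refine ⟨v, N + 1, by omega, fun n hn => ?_, fun n _ => ?_⟩
    · rw [hv, hw, if_pos (by push_cast; omega), hx]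
    · rw [hv]; congr 1; ring
  obtain ⟨δ, hδ, hc⟩ := h ((1 - s k) / 2) (by linarith)
  obtain ⟨m, c, hmc, h0, hm⟩ := hxw δ hδ
  have h1 := hc m c hmc (h0 ▸ hxk)
  have h2 : 1 - s k ≤ Metric.infDist (c m) (levelSet s k) := by
    refine (Metric.le_infDist ⟨x, hxk⟩).2 fun y hy => ?_
    have h3 := SeqSpace.weighted_le_dist (c m).1 y.1 0
    have h4 := abs_sub_abs_le_abs_sub ((c m).1.coord 0) (y.1.coord 0)
    rw [(mem_levelSet_iff hs hk).1 hy, hm, hw, if_neg (by omega), abs_neg, abs_one] at h4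
    rw [hm, hw, if_neg (by omega)] at h3
    simp only [Int.natAbs_zero, pow_zero, one_mul] at h3
    rw [hm]
    exact h4.trans h3
  linarith

theorem terminalChainComponents_exampleMap (hs : IsAdmissible s) :
    terminalChainComponents (exampleMap s) = {limitSet s} := by
  ext C
  constructor
  · rintro ⟨hC, hst⟩
    rw [chainComponents_exampleMap hs] at hC
    rcases hC with hC | ⟨k, hk, rfl⟩
    · exact hC
    · exact absurd hst (not_isChainStable_levelSet hs hk)
  · rintro rfl
    exact ⟨by rw [chainComponents_exampleMap hs]; exact Or.inl rfl, isChainStable_limitSet hs⟩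

end Example

/-! ### Shadowing -/

section Shadowing

variable {s : ℕ → ℝ}

/-- The shadowing point lies in the truncated system at a level $K$ with $1-s_K\le\epsilon$, where
legality is decided by $K+1$ consecutive letters. -/
theorem hasShadowing_exampleMap (hs : IsAdmissible s) : HasShadowing (exampleMap s) := by
  intro ε hε
  obtain ⟨N, hN⟩ := SeqSpace.exists_window hε
  obtain ⟨K, hK, hNK, hKε⟩ := hs.exists_one_sub_le N hε
  obtain ⟨δ, hδ, hstep⟩ := exists_clamp_step hs hK K
  refine ⟨δ, hδ, fun x hx => ?_⟩
  have hiter : ∀ (j i : ℕ) (n : ℤ), -K ≤ n → n + j ≤ K + 1 →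
      clamp (s K) ((x (i + j)).1.coord n) = clamp (s K) ((x i).1.coord (n + j)) := by
    intro j
    induction j with
    | zero => intro i n _ _; simp
    | succ j ih =>
      intro i n h1 h2
      push_cast at h2
      rw [← add_assoc, hstep _ _ (hx (i + j)) n (by omega), ih i (n + 1) (by omega) (by omega)]
      congr 2; push_cast; ring
  -- The past is read from `x 0`, the letter at time `m ≥ 0` from coordinate `0` of `x m`.
  let a : ℤ → ℝ := fun m => clamp (s K) ((x m.toNat).1.coord (min m 0))
  have hwin : ∀ (i : ℕ) (n : ℤ), n.natAbs ≤ K → a (i + n) = clamp (s K) ((x i).1.coord n) := by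
    intro i n hn
    simp only [a]
    rcases le_total 0 n with h0 | h0
    · obtain ⟨j, rfl⟩ := Int.eq_ofNat_of_zero_le h0
      rw [min_eq_right (by omega), show ((i : ℤ) + j).toNat = i + j by omega,
        hiter j i 0 (by omega) (by omega), zero_add]
    · rcases le_total 0 (i + n) with h1 | h1
      · rw [min_eq_right h1]
        have := hiter (-n).toNat (i + n).toNat n (by omega) (by omega)
        rw [show (i + n).toNat + (-n).toNat = i by omega,
          show n + ((-n).toNat : ℤ) = 0 by omega] at this
        exact this.symm
      · rw [min_eq_left h1, show (i + n).toNat = 0 by omega]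
        have := hiter i 0 n (by omega) (by omega)
        rw [zero_add] at this
        rw [this, add_comm n]
  -- Every stretch of `K + 1` letters of `a` is a truncated stretch of one legal sequence.
  have hloc : ∀ m : ℤ, ∃ (g : ℤ → ℝ) (p : ℤ), Legal s g ∧
      ∀ j : ℕ, j ≤ K → a (m + j) = clamp (s K) (g (p + j)) := by
    intro m
    rcases le_total 0 m with h0 | h0
    · obtain ⟨i, rfl⟩ := Int.eq_ofNat_of_zero_le h0
      exact ⟨_, 0, legal_coord hs (x i), fun j hj => by rw [hwin i j (by omega), zero_add]⟩
    · refine ⟨_, m, legal_coord hs (x 0), fun j hj => ?_⟩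
      rcases le_total (m + j) 0 with h1 | h1
      · simp only [a]
        rw [min_eq_left h1, show (m + j).toNat = 0 by omega]
      · have := hwin 0 (m + j) (by omega)
        rwa [Nat.cast_zero, zero_add] at this
  have hlegal : Legal s a := by
    refine ⟨fun m => ?_, fun m => ?_, fun m k hk hm => ?_⟩ <;>
      obtain ⟨g, p, hg, hgp⟩ := hloc m <;> have hcl := hg.clamp hs hK <;>
      have h0 := hgp 0 (by omega) <;> simp only [Nat.cast_zero, add_zero] at h0
    · rw [h0]; exact hcl.mem p
    · have h1 := hgp 1 hK
      rw [Nat.cast_one] at h1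
      rw [h0, h1]
      exact hcl.mono p
    · have hkK : k ≤ K := by
        refine hs.le_of_le_val hK (hm.trans ?_)
        rw [h0]
        exact max_le (by linarith [hs.pos hK]) (min_le_left _ _)
      rw [hgp k hkK, h0]
      exact hcl.neg p k hk (h0 ▸ hm)
  obtain ⟨y, hy⟩ := hlegal.exists_point hs
  refine ⟨y, fun i => SeqSpace.dist_le_of_window hN fun n hn => ?_⟩
  rw [iterate_coord, hy, add_comm, hwin i n (hn.trans hNK)]
  exact (abs_clamp_sub_self_le (hs.pos hK) (hs.le_one hK)
    (SeqSpace.abs_coord_le_one _ _)).trans hKε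

theorem HasShadowing.shadowablePoints_eq {X : Type*} [MetricSpace X] {f : X → X}
    (h : HasShadowing f) : shadowablePoints f = univ := by
  refine eq_univ_of_forall fun p ε hε => ?_
  obtain ⟨δ, hδ, hx⟩ := h ε hε
  exact ⟨δ, hδ, fun x hxδ _ => hx x hxδ⟩

theorem exists_isAdmissible : ∃ s : ℕ → ℝ, IsAdmissible s := by
  refine ⟨fun k => 1 - 1 / ((k : ℝ) + 1), by norm_num, fun k _ => ?_, ?_⟩
  · have : 1 / ((k : ℝ) + 1 + 1) < 1 / ((k : ℝ) + 1) :=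
      one_div_lt_one_div_of_lt (by positivity) (by linarith)
    push_cast
    linarith
  · simpa using tendsto_one_div_add_atTop_nhds_zero_nat.const_sub (1 : ℝ)

end Shadowing

/-! ### Growth rates -/

theorem log_natCast_div (a n : ℕ) (ha : 1 ≤ a) :
    ENNReal.log (((a : ℕ∞) : ENNReal)) / (n : EReal) = ((Real.log a / n : ℝ) : EReal) := by
  have h : (((a : ℕ∞) : ENNReal)) = ENNReal.ofReal a := by simp
  rw [h, ENNReal.log_ofReal_of_pos (by exact_mod_cast ha), EReal.coe_div]
  rfl

theorem log_div_mono {a b : ℕ∞} (h : a ≤ b) (n : ℕ) :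
    ENNReal.log (a : ENNReal) / (n : EReal) ≤ ENNReal.log (b : ENNReal) / (n : EReal) :=
  EReal.div_le_div_right_of_nonneg (by positivity)
    (ENNReal.log_monotone (ENat.toENNReal_le.2 h))

/-! ### Positive cover entropy from independence -/

section Cover

/-- A member of the refined cover avoids `A` or avoids `B` at each time `j * L < n`, so it contains
at most one of the points `x P` with `P` a subset of `range (n / L)`. -/
theorem two_pow_le_minSubcoverCard {X : Type*} {f : X → X} {A B : Set X} {L : ℕ} (hL : 1 ≤ L)
    (h : ∀ P : Finset ℕ, ∃ x, ∀ j, (j ∈ P → f^[j * L] x ∈ A) ∧ (j ∉ P → f^[j * L] x ∈ B))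
    (n : ℕ) : ((2 ^ (n / L) : ℕ) : ℕ∞) ≤ minSubcoverCard (iteratedCover f {Aᶜ, Bᶜ} n) := by
  refine le_iInf₂ fun F ⟨hF, hcov⟩ => ?_
  choose x hx using h
  have hV : ∀ P, ∃ V ∈ F, x P ∈ V := fun P => by
    have : x P ∈ ⋃₀ (F : Set (Set X)) := hcov ▸ mem_univ _
    simpa using this
  choose V hVF hxV using hV
  have hcard : (Finset.range (n / L)).powerset.card ≤ F.card := by
    refine Finset.card_le_card_of_injOn V (fun P _ => hVF P) fun P hP Q hQ hPQ => ?_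
    obtain ⟨c, hc, hVc⟩ := hF (hVF P)
    have hxP := hxV P
    have hxQ := hxV Q
    rw [← hPQ] at hxQ
    rw [hVc] at hxP hxQ
    ext j
    by_cases hj : j < n / L
    · have hjn : j * L < n :=
        ((Nat.mul_lt_mul_right hL).2 hj).trans_le (Nat.div_mul_le_self n L)
      have h1 := hxP _ hjn
      have h2 := hxQ _ hjn
      rcases hc _ hjn with h | h <;> rw [h] at h1 h2
      · exact iff_of_false (fun hjP => h1 ((hx P j).1 hjP)) (fun hjQ => h2 ((hx Q j).1 hjQ))
      · exact iff_of_true (by_contra fun hjP => h1 ((hx P j).2 hjP))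
          (by_contra fun hjQ => h2 ((hx Q j).2 hjQ))
    · have hP := Finset.mem_powerset.1 hP
      have hQ := Finset.mem_powerset.1 hQ
      exact iff_of_false (fun h => hj (Finset.mem_range.1 (hP h)))
        (fun h => hj (Finset.mem_range.1 (hQ h)))
  rw [Finset.card_powerset, Finset.card_range] at hcard
  exact_mod_cast hcard

theorem openCoverEntropy_pos_of_independent {X : Type*} {f : X → X} {A B : Set X} {L : ℕ}
    (hL : 1 ≤ L)
    (h : ∀ P : Finset ℕ, ∃ x, ∀ j, (j ∈ P → f^[j * L] x ∈ A) ∧ (j ∉ P → f^[j * L] x ∈ B)) :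
    0 < openCoverEntropy f {Aᶜ, Bᶜ} := by
  have hL0 : (0 : ℝ) < L := by exact_mod_cast hL
  have hlog : 0 < Real.log 2 := Real.log_pos (by norm_num)
  have hpos : (0 : EReal) < ((Real.log 2 / (2 * L) : ℝ) : EReal) := by
    exact_mod_cast (by positivity : 0 < Real.log 2 / (2 * L))
  refine hpos.trans_le (le_limsup_of_frequently_le (Eventually.frequently ?_))
  filter_upwards [eventually_ge_atTop L] with n hn
  have hn0 : (0 : ℝ) < n := by exact_mod_cast (by omega : 0 < n)
  refine le_trans ?_ (log_div_mono (two_pow_le_minSubcoverCard hL h n) n)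
  rw [log_natCast_div _ _ Nat.one_le_two_pow, EReal.coe_le_coe_iff]
  push_cast
  rw [Real.log_pow, div_le_div_iff₀ (by positivity) hn0]
  have hq : n ≤ n / L * (2 * L) := by
    have h1 : 1 ≤ n / L := (Nat.one_le_div_iff hL).2 hn
    have h2 := Nat.div_add_mod n L
    have h3 := Nat.mod_lt n hL
    nlinarith
  have hq' : (n : ℝ) ≤ (n / L : ℕ) * (2 * L) := by exact_mod_cast hq
  nlinarith

theorem IsEntropyPair.symm {X : Type*} [MetricSpace X] {f : X → X} {x y : X}
    (h : IsEntropyPair f x y) :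
    IsEntropyPair f y x :=
  ⟨h.1.symm, fun A B hA hAy hB hBx hAB => by
    rw [pair_comm]
    exact h.2 B A hB hBx hA hAy (by rwa [inter_comm])⟩

end Cover

/-! ### Entropy pairs and entropy bounds at the limit set -/

section Example

variable {s : ℕ → ℝ}

/-- Points close to a given point on a window lie in a given neighbourhood. -/
theorem exists_window_subset {x : exampleSet s} {A : Set (exampleSet s)} (hA : A ∈ 𝓝 x) :
    ∃ (N : ℕ) (η : ℝ), 0 < η ∧ ∀ M, N ≤ M → ∀ y : exampleSet s,
      (∀ n : ℤ, n.natAbs ≤ M → |y.1.coord n - x.1.coord n| ≤ η) → y ∈ A := by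
  obtain ⟨ε, hε, h⟩ := Metric.mem_nhds_iff.1 hA
  obtain ⟨N, hN⟩ := SeqSpace.exists_window (half_pos hε)
  refine ⟨N, ε / 2, half_pos hε, fun M hM y hy => h ?_⟩
  have : dist y x ≤ ε / 2 :=
    SeqSpace.dist_le_of_window hN fun n hn => hy n (hn.trans hM)
  exact Metric.mem_ball.2 (by linarith)

theorem isEntropyPair_zPtAt_zPt (hs : IsAdmissible s) (m : ℤ) :
    IsEntropyPair (exampleMap s) (zPtAt hs m) (zPt hs) := by
  refine ⟨fun h => ?_, fun A B _ hA _ hB _ => ?_⟩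
  · have := zPtAt_coord hs m m
    rw [h, zPt_coord, if_pos rfl] at this
    linarith
  · obtain ⟨N₁, η₁, hη₁, hA⟩ := exists_window_subset hA
    obtain ⟨N₂, η₂, hη₂, hB⟩ := exists_window_subset hB
    obtain ⟨k, hk, -, hkη⟩ := hs.exists_one_sub_le 0 (lt_min hη₁ hη₂)
    have hpos := hs.pos hk
    have hlt := hs.lt_one hk
    let N := max m.natAbs (max N₁ N₂)
    have hm : m.natAbs ≤ N := le_max_left _ _
    -- Positive letters go to `m + j * L` for `j ∈ P`. The spacing exceeds `k`, for legality, and `2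
    -- * N`, so that the window at time `j * L` sees no other one. As `N` is at least $|m|$, it does
    -- see the position `m`.
    let L := 2 * N + k + 1
    have hLk : k < L := by omega
    refine openCoverEntropy_pos_of_independent (L := L) (by omega) fun P => ?_
    classical
    have hsep : ∀ (a b : ℕ) (c : ℤ), (a : ℤ) * L = b * L + c → c.natAbs < L → a = b := by
      intro a b c h hc
      have h1 : ((a : ℤ) - b) * L = c := by linarith
      by_contra hab
      have h2 : 1 ≤ ((a : ℤ) - b).natAbs := by omega
      have h3 : c.natAbs = ((a : ℤ) - b).natAbs * L := by
        rw [← h1, Int.natAbs_mul, Int.natAbs_natCast]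
      nlinarith
    have hleg : Legal s fun n : ℤ => if ∃ j ∈ P, n = m + j * L then s k else -s k := by
      refine legal_of_level hs hk (fun n => ?_) fun n i hi hik hn => ?_
      · split_ifs <;> simp
      · split_ifs at hn with h
        · obtain ⟨j, -, rfl⟩ := h
          rw [if_neg]
          rintro ⟨j', -, h'⟩
          have := hsep j' j i (by linarith) (by omega)
          subst this
          omega
        · linarith
    obtain ⟨x, hx⟩ := hleg.exists_point hs
    have hcoord : ∀ (j : ℕ) (n : ℤ), n.natAbs ≤ N →
        ((exampleMap s)^[j * L] x).1.coord n = if n = m ∧ j ∈ P then s k else -s k := by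
      intro j n hn
      rw [iterate_coord, hx]
      refine if_congr ⟨?_, ?_⟩ rfl rfl
      · rintro ⟨i, hi, h⟩
        push_cast at h
        have := hsep i j (n - m) (by linarith) (by omega)
        subst this
        exact ⟨by linarith, hi⟩
      · rintro ⟨rfl, hj⟩
        exact ⟨j, hj, by push_cast; ring⟩
    have hk1 : |s k - 1| ≤ min η₁ η₂ := by rw [abs_sub_comm, abs_of_pos] <;> linarith
    have hk2 : |-s k - -1| ≤ min η₁ η₂ := by
      rwa [← abs_neg, show -(-s k - -1) = s k - 1 by ring]
    refine ⟨x, fun j => ⟨fun hj => hA N ?_ _ fun n hn => ?_, fun hj => hB N ?_ _ fun n hn => ?_⟩⟩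
    · exact (le_max_left _ _).trans (le_max_right _ _)
    · rw [hcoord j n hn, zPtAt_coord]
      by_cases hnm : n = m
      · simpa [hnm, hj] using hk1.trans (min_le_left _ _)
      · simpa [hnm] using hk2.trans (min_le_left _ _)
    · exact (le_max_right _ _).trans (le_max_right _ _)
    · rw [hcoord j n hn, zPt_coord, if_neg (fun h => hj h.2)]
      exact hk2.trans (min_le_right _ _)

theorem limitSet_subset_cEntropyPoints (hs : IsAdmissible s) :
    limitSet s ⊆ cEntropyPoints (exampleMap s) := by
  intro x hx
  rcases eq_zPt_or_zPtAt hs hx with rfl | ⟨m, rfl⟩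
  · exact ⟨_, (isEntropyPair_zPtAt_zPt hs 0).symm⟩
  · exact ⟨_, isEntropyPair_zPtAt_zPt hs m⟩

/-! ### No uniform entropy at the limit set -/

/-- Points that have high level from the coordinate `-W` on are described, up to the scale `r` and
for `n` time units, by the positions of their positive coordinates in blocks of length `M`. -/
theorem sepCard_le (hs : IsAdmissible s) {W M : ℕ} {r : ℝ} (hM : 1 ≤ M)
    (hW : 2 * (1 / 2 : ℝ) ^ W ≤ r) (hr : 1 - s M ≤ r) (n : ℕ) :
    sepCard (exampleMap s) {y | s M ≤ |y.1.coord (-W)|} r n ≤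
      (((M + 1) ^ ((n + 2 * W) / M + 1) : ℕ) : ℕ∞) := by
  refine iSup₂_le fun E ⟨hEK, hE⟩ => ?_
  have hlev : ∀ y ∈ E, ∀ n : ℤ, -W ≤ n → s M ≤ |y.1.coord n| := fun y hy n hn =>
    (hEK hy : s M ≤ |y.1.coord (-W)|).trans ((legal_coord hs y).abs_le_abs hn)
  -- The code of a block is the position of its only positive letter, with the value `M` for none.
  have hcode : ∀ (y : exampleSet s) (b : ℕ), ∃ q : Fin (M + 1), y ∈ E → ∀ p : ℕ, p < M →
      (0 < y.1.coord (-W + b * M + p) ↔ (q : ℕ) = p) := by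
    intro y b
    by_cases h : ∃ p, p < M ∧ 0 < y.1.coord (-W + b * M + p)
    · obtain ⟨p, hp, hpos⟩ := h
      refine ⟨⟨p, by omega⟩, fun hy p' hp' => ⟨fun hpos' => ?_, fun h => ?_⟩⟩
      · have hbM : (0 : ℤ) ≤ b * M := by positivity
        have := (legal_coord hs y).eq_of_pos hs (hlev y hy _ (by omega)) (hlev y hy _ (by omega))
          hpos hpos' (by omega) (by omega)
        simpa using this
      · simp only at h
        rwa [← h]
    · refine ⟨⟨M, by omega⟩, fun _ p hp => iff_of_false (fun h' => h ⟨p, hp, h'⟩) ?_⟩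
      simp only
      omega
  choose q hq using hcode
  let code : exampleSet s → Fin ((n + 2 * W) / M + 1) → Fin (M + 1) := fun y b => q y b
  have hcard : E.card ≤ (Finset.univ : Finset (Fin ((n + 2 * W) / M + 1) → Fin (M + 1))).card := by
    refine Finset.card_le_card_of_injOn code (fun _ _ => Finset.mem_univ _) fun y hy y' hy' h => ?_
    by_contra hne
    obtain ⟨i, hi, hlt⟩ := hE y hy y' hy' hne
    -- Equal codes give equal signs on all coordinates from `-W` to `n - 1 + W`, and letters of
    -- equal sign and modulus at least `s M` differ by at most `1 - s M ≤ r`.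
    refine absurd hlt (not_lt.2 (SeqSpace.dist_le_of_window hW fun l hl => ?_))
    rw [iterate_coord, iterate_coord]
    refine (abs_sub_le_of_same_sign (hlev y hy _ (by omega))
      (hlev y' hy' _ (by omega)) (SeqSpace.abs_coord_le_one _ _)
      (SeqSpace.abs_coord_le_one _ _) ?_).trans hr
    obtain ⟨t, ht⟩ := Int.eq_ofNat_of_zero_le (show 0 ≤ l + i + W by omega)
    have htn : t / M < (n + 2 * W) / M + 1 :=
      Nat.lt_succ_of_le (Nat.div_le_div_right (by omega))
    have hidx : l + i = -W + ((t / M : ℕ) : ℤ) * M + ((t % M : ℕ) : ℤ) := by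
      have : ((t / M * M + t % M : ℕ) : ℤ) = t := by rw [Nat.div_add_mod']
      push_cast at this ⊢
      linarith
    have hqq : q y (t / M) = q y' (t / M) := congrFun h ⟨t / M, htn⟩
    rw [hidx, hq y _ hy _ (Nat.mod_lt _ hM), hq y' _ hy' _ (Nat.mod_lt _ hM), hqq]
  simp only [Finset.card_univ, Fintype.card_fun, Fintype.card_fin] at hcard
  exact_mod_cast hcard

theorem sepEntropy_le (hs : IsAdmissible s) {W M : ℕ} {r : ℝ} (hM : 1 ≤ M)
    (hW : 2 * (1 / 2 : ℝ) ^ W ≤ r) (hr : 1 - s M ≤ r) :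
    sepEntropy (exampleMap s) {y | s M ≤ |y.1.coord (-W)|} r ≤
      ((2 * (Real.log (M + 1) / M) : ℝ) : EReal) := by
  refine limsup_le_of_le (h := ?_)
  filter_upwards [eventually_ge_atTop (2 * W + M)] with n hn
  have hn0 : (0 : ℝ) < n := by exact_mod_cast (by omega : 0 < n)
  have hM0 : (0 : ℝ) < M := by exact_mod_cast hM
  have hlog : 0 ≤ Real.log (M + 1) := Real.log_nonneg (by linarith)
  refine (log_div_mono (sepCard_le hs hM hW hr n) n).trans ?_
  rw [log_natCast_div _ _ (Nat.one_le_pow _ _ (by omega)), EReal.coe_le_coe_iff]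
  push_cast
  rw [Real.log_pow, div_le_iff₀ hn0]
  -- The factor `2` absorbs the window and the incomplete block, by `2 * W + M ≤ n`.
  have h1 : ((n + 2 * W) / M + 1) * M ≤ 2 * n := by
    rw [add_mul, one_mul]
    have := Nat.div_mul_le_self (n + 2 * W) M
    omega
  have h2 : (((n + 2 * W) / M + 1 : ℕ) : ℝ) * M ≤ 2 * n := by exact_mod_cast h1
  calc (((n + 2 * W) / M + 1 : ℕ) : ℝ) * Real.log (M + 1)
      = ((((n + 2 * W) / M + 1 : ℕ) : ℝ) * M) * (Real.log (M + 1) / M) := by field_simp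
    _ ≤ (2 * n) * (Real.log (M + 1) / M) := by gcongr
    _ = _ := by ring

theorem tendsto_log_add_one_div : Tendsto (fun M : ℕ => Real.log (M + 1) / M) atTop (𝓝 0) := by
  have h := (Real.tendsto_pow_log_div_mul_add_atTop 1 (-1) 1 one_ne_zero).comp
    (tendsto_atTop_add_const_right atTop (1 : ℝ) tendsto_natCast_atTop_atTop)
  simpa [Function.comp_def] using h

theorem notMem_uniformEntropyPoints_of_mem_limitSet (hs : IsAdmissible s) {x : exampleSet s}
    (hx : x ∈ limitSet s) : x ∉ uniformEntropyPoints (exampleMap s) := by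
  rintro ⟨r, b, hr, hb, h⟩
  obtain ⟨W, hW⟩ := SeqSpace.exists_window hr
  -- The scale `r` and the rate `b` are given first. The level `M`, and with it the neighbourhood,
  -- is chosen afterwards so that `2 * (log (M + 1) / M) < b`.
  have hev := tendsto_log_add_one_div.eventually (gt_mem_nhds (show 0 < b / 2 by linarith))
  obtain ⟨M₀, hM₀⟩ := eventually_atTop.1 hev
  obtain ⟨M, hM, hMM, hMr⟩ := hs.exists_one_sub_le M₀ hr
  have hc : Continuous fun y : exampleSet s => |y.1.coord (-W)| :=
    ((SeqSpace.continuous_coord _).comp continuous_subtype_val).abs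
  have h1 := h {y | s M ≤ |y.1.coord (-W)|} (isClosed_le continuous_const hc)
    (mem_of_superset ((isOpen_lt continuous_const hc).mem_nhds (x := x) (by
      change s M < |x.1.coord (-W)|
      rw [mem_limitSet_iff.1 hx]
      exact hs.lt_one hM)) fun y (hy : s M < |y.1.coord (-W)|) => hy.le)
  have h2 := EReal.coe_le_coe_iff.1 (h1.trans (sepEntropy_le hs hM hW hMr))
  have h3 := hM₀ M hMM
  linarith

end Example

end TopDyn

theorem limitSet_subset_diff {s : ℕ → ℝ} (hs : IsAdmissible s) :
    limitSet s ⊆ cEntropyPoints (exampleMap s) \ uniformEntropyPoints (exampleMap s) :=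
  fun _ hx => ⟨limitSet_subset_cEntropyPoints hs hx,
    notMem_uniformEntropyPoints_of_mem_limitSet hs hx⟩

theorem mainTheorem4 :
    (∀ s : ℕ → ℝ, IsAdmissible s →
      IsClosed (exampleSet s) ∧
      CompactSpace (exampleSet s) ∧
      IsHomeomorph (exampleMap s) ∧
      (Subtype.val '' limitSet s = {SeqSpace.zPoint} ∪ Set.range SeqSpace.zPointAt) ∧
      chainRecurrentSet (exampleMap s) =
        {x | ∀ n : ℤ, |x.1.coord n| = |x.1.coord (n + 1)|} ∧
      chainRecurrentSet (exampleMap s) =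
        limitSet s ∪ ⋃ (k : ℕ) (_ : 1 ≤ k), levelSet s k ∧
      chainComponents (exampleMap s) =
        {limitSet s} ∪ {C | ∃ k : ℕ, 1 ≤ k ∧ C = levelSet s k} ∧
      terminalChainComponents (exampleMap s) = {limitSet s} ∧
      (limitSet s).Infinite ∧
      limitSet s ⊆ cEntropyPoints (exampleMap s) \ uniformEntropyPoints (exampleMap s)) ∧
    (∃ s : ℕ → ℝ, IsAdmissible s ∧
      HasShadowing (exampleMap s) ∧
      shadowablePoints (exampleMap s) = Set.univ) ∧
    ¬ (∀ (Y : Type) [MetricSpace Y] [CompactSpace Y] (g : Y ≃ₜ Y),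
        cEntropyPoints g ⊆ uniformEntropyPoints g) := by

  refine ⟨fun s hs => ⟨isClosed_exampleSet hs, compactSpace_exampleSet hs,
    isHomeomorph_exampleMap hs, image_limitSet hs, chainRecurrentSet_exampleMap hs,
    (chainRecurrentSet_exampleMap hs).trans (constant_modulus_eq_union hs),
    chainComponents_exampleMap hs, terminalChainComponents_exampleMap hs, infinite_limitSet hs,
    limitSet_subset_diff hs⟩, ?_, fun h => ?_⟩
  -- Any admissible sequence will do, both here and for the counterexample.
  · obtain ⟨s, hs⟩ := exists_isAdmissible
    exact ⟨s, hs, hasShadowing_exampleMap hs, (hasShadowing_exampleMap hs).shadowablePoints_eq⟩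
  · obtain ⟨s, hs⟩ := exists_isAdmissible
    have := compactSpace_exampleSet hs
    obtain ⟨h1, h2⟩ := limitSet_subset_diff hs (zPt_mem hs)
    exact h2 (h (exampleSet s) ((isHomeomorph_exampleMap hs).homeomorph (exampleMap s)) h1)
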